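/- For positive integers $p$ and $q$ with $1 \le q \le \binom{p}{2}$, a $(p,q)$-coloring of the complete graph $K_n$ is an edge-coloring of $K_n$ in which every $p$-clique contains edges of at least $q$ distinct colors, and $f(n,p,q)$ denotes the minimum number of colors needed for a $(p,q)$-coloring of $K_n$. Then, as $n \to \infty$, \[ f(n,6,6) \le n^{1/3+o(1)} \qquad\text{and}\qquad f(n,8,8) \le n^{1/4+o(1)}. \] -/

import Mathlib

open Filter Topology

/-- The set of colors that the edge-coloring `C` of `G` uses on the edges with both ends in `S`. -/
def colorsOn {V K : Type*} {G : SimpleGraph V} (C : G.EdgeLabeling K) (S : Finset V) : Set K :=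
  {c | ∃ x ∈ S, ∃ y ∈ S, ∃ h : G.Adj x y, C.get x y h = c}

/-- An edge-coloring of `G` is a `(p,q)`-coloring if every `p`-clique of `G` contains edges of at
least `q` distinct colors. -/
def IsPQColoring {V K : Type*} {G : SimpleGraph V} (C : G.EdgeLabeling K) (p q : ℕ) : Prop :=
  ∀ S : Finset V, G.IsNClique p S → (q : ℕ∞) ≤ (colorsOn C S).encard

/-- The Erdős–Gyárfás function `f(n,p,q)`: the minimum number of colors needed to give a
`(p,q)`-coloring of the complete graph on `n` vertices. -/
noncomputable def erdosGyarfas (n p q : ℕ) : ℕ :=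
  sInf {k : ℕ | ∃ C : SimpleGraph.TopEdgeLabeling (Fin n) (Fin k), IsPQColoring C p q}

/-- For `q ≤ p.choose 2` a `(p,q)`-coloring of the complete graph exists, so that the minimum in
`erdosGyarfas` is over a nonempty set. -/
theorem exists_isPQColoring (n p q : ℕ) (hq : q ≤ p.choose 2) :
    {k : ℕ | ∃ C : SimpleGraph.TopEdgeLabeling (Fin n) (Fin k), IsPQColoring C p q}.Nonempty := by
  classical
  let e := Fintype.equivFin (⊤ : SimpleGraph (Fin n)).edgeSet
  refine ⟨_, fun x => e x, fun S hS => ?_⟩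
  set D : SimpleGraph.TopEdgeLabeling (Fin n) _ := fun x => e x
  have hinj : Function.Injective (fun x => ((e.symm x : (⊤ : SimpleGraph (Fin n)).edgeSet) :
      Sym2 (Fin n))) := Subtype.val_injective.comp e.symm.injective
  have hsub : ((S.offDiag.image (fun z : Fin n × Fin n => s(z.1, z.2)) : Finset (Sym2 (Fin n))) :
      Set (Sym2 (Fin n))) ⊆ (fun x => ((e.symm x : (⊤ : SimpleGraph (Fin n)).edgeSet) :
      Sym2 (Fin n))) '' colorsOn D S := by
    intro z hz
    simp only [Finset.coe_image, Set.mem_image, Finset.mem_coe, Finset.mem_offDiag] at hz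
    obtain ⟨⟨x, y⟩, ⟨hx, hy, hxy⟩, rfl⟩ := hz
    refine ⟨_, ⟨x, hx, y, hy, hxy, rfl⟩, ?_⟩
    simp [SimpleGraph.EdgeLabeling.get, D]
  have h1 := Set.encard_le_encard hsub
  rw [hinj.encard_image, Set.encard_coe_eq_coe_finsetCard] at h1
  have h2 : (S.offDiag.image (fun z : Fin n × Fin n => s(z.1, z.2))).card = S.card.choose 2 :=
    Sym2.card_image_offDiag S
  rw [h2, hS.card_eq] at h1
  exact le_trans (by exact_mod_cast hq) h1

/-- For `q ≤ p.choose 2` the minimum in `erdosGyarfas` is attained. -/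
theorem erdosGyarfas_isLeast (n p q : ℕ) (hq : q ≤ p.choose 2) :
    IsLeast {k : ℕ | ∃ C : SimpleGraph.TopEdgeLabeling (Fin n) (Fin k), IsPQColoring C p q}
      (erdosGyarfas n p q) :=
  ⟨Nat.sInf_mem (exists_isPQColoring n p q hq), fun _ hk => Nat.sInf_le hk⟩

/-!
Vertices are colored by a pair. The first component, with `n ^ o(1)` colors, is of the kind used by
Mubayi and by Conlon, Fox, Lee and Sudakov: vertices are words over an alphabet `V`, ordered
lexicographically, and the color of two words consists of the first place where they differ, the two
letters there, and, for every later place, the color of the two letters under a coloring `c` of `V`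
with logarithmically many colors. The point is that this coloring is *tight* (`IsTight`): a set of
at most eight words gets at least one color less than it has elements, and if it gets no more, it
is the leaf set of a binary tree, all pairs of leaves separated at the same node having the same
color (`IsTree`). Tightness is proved by adding one letter at a time (`IsTight.extend`). If a pair
of last letters `u`, `v` occurs with only one prefix, then this pair has a color of its own and `u`
can be removed (`card_le_of_unique_fiber`); if every such pair occurs with several prefixes `y`,
`y'`, then the color of `y`, `y'` splits into at least three, as `c` distinguishes equal, increasing
and decreasing pairs of letters, and there are too many colors (`card_le_of_double_fibers`).

The second component identifies vertices with vectors in `F_q ^ d` without zero coordinates, where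
`n` is about `q ^ d`, and is essentially the dot product. If all pairs in `A × B` have the same dot
product, then the span of `A` is orthogonal to all differences of elements of `B`. The exceptional
values `0`, `x ⬝ᵥ x`, `y ⬝ᵥ y` of the dot product are replaced by a coordinate of `y - x`, so that
in all cases the affine spans of `A` and `B` have smaller dimension than that of `A ∪ B`, and these
two dimensions have sum less than `d` (`affineRank_of_dotColor_eq`). By induction on the tree, a
tree for this coloring has at most five leaves for `d = 3` and at most seven leaves for `d = 4`
(`card_le_of_isTree_dotColor`).

A set of six (eight) vertices with fewer than six (eight) colors would be a tree for the first
component and, since it already has as many colors there, for the pair of components, hence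
for the second component; this contradicts the bound on the number of leaves (`erdosGyarfas_le`).
-/

namespace ErdosGyarfas

/-! ### Trees and tight colorings -/

section Trees

variable {α β K K' : Type*} [LinearOrder α] [LinearOrder β]

open Classical in
/-- The set of values `f x y` over the pairs `x < y` of elements of `S`. -/
noncomputable def colors (f : α → α → K) (S : Finset α) : Finset K :=
  ((S ×ˢ S).filter fun p => p.1 < p.2).image fun p => f p.1 p.2

theorem mem_colors {f : α → α → K} {S : Finset α} {k : K} :
    k ∈ colors f S ↔ ∃ x ∈ S, ∃ y ∈ S, x < y ∧ f x y = k := by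
  simp only [colors, Finset.mem_image, Finset.mem_filter, Finset.mem_product, Prod.exists]
  constructor
  · rintro ⟨x, y, ⟨⟨hx, hy⟩, hxy⟩, h⟩
    exact ⟨x, hx, y, hy, hxy, h⟩
  · rintro ⟨x, hx, y, hy, hxy, h⟩
    exact ⟨x, y, ⟨⟨hx, hy⟩, hxy⟩, h⟩

theorem mem_colors_of {f : α → α → K} {S : Finset α} {x y : α} (hx : x ∈ S) (hy : y ∈ S)
    (hxy : x < y) : f x y ∈ colors f S :=
  mem_colors.2 ⟨x, hx, y, hy, hxy, rfl⟩

theorem colors_mono (f : α → α → K) {S T : Finset α} (h : S ⊆ T) : colors f S ⊆ colors f T := by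
  intro k hk
  obtain ⟨x, hx, y, hy, hxy, e⟩ := mem_colors.1 hk
  exact mem_colors.2 ⟨x, h hx, y, h hy, hxy, e⟩

/-- `S` is the leaf set of a binary tree such that all pairs of leaves separated at a given
node get the same color, the leaves in the left branch being smaller than those in the right one.
The colors at different nodes are not required to be different. -/
inductive IsTree (f : α → α → K) : Finset α → Prop
  | single (a : α) : IsTree f {a}
  | node {A B : Finset α} : IsTree f A → IsTree f B → (∀ a ∈ A, ∀ b ∈ B, a < b) →
      (∀ a ∈ A, ∀ b ∈ B, ∀ a' ∈ A, ∀ b' ∈ B, f a b = f a' b') → IsTree f (A ∪ B)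

theorem IsTree.nonempty {f : α → α → K} {S : Finset α} (h : IsTree f S) : S.Nonempty := by
  induction h with
  | single a => exact Finset.singleton_nonempty a
  | node _ _ _ _ ih _ => exact ih.mono Finset.subset_union_left

/-- A tree structure on the image of `S` under a strictly increasing map lifts to `S` along a
coloring that is constant wherever the coloring of the image is. -/
theorem IsTree.of_image {f : β → β → K} {f' : α → α → K'} {g : α → β} {T : Finset β}
    (hT : IsTree f T) : ∀ S : Finset α, S.image g = T →
      (∀ x ∈ S, ∀ y ∈ S, g x = g y → x = y) →
      (∀ x ∈ S, ∀ y ∈ S, g x < g y → x < y) →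
      (∀ x ∈ S, ∀ y ∈ S, ∀ x' ∈ S, ∀ y' ∈ S, x < y → x' < y' →
        f (g x) (g y) = f (g x') (g y') → f' x y = f' x' y') → IsTree f' S := by
  induction hT with
  | single b =>
    intro S hS hinj _ _
    have hne : S.Nonempty := by
      rw [← Finset.image_nonempty (f := g), hS]; exact Finset.singleton_nonempty b
    obtain ⟨a, ha⟩ := hne
    have hb : ∀ x ∈ S, g x = b := fun x hx =>
      Finset.mem_singleton.1 (hS ▸ Finset.mem_image_of_mem g hx)
    have : S = {a} := by
      refine Finset.eq_singleton_iff_unique_mem.2 ⟨ha, fun x hx => ?_⟩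
      exact hinj x hx a ha ((hb x hx).trans (hb a ha).symm)
    rw [this]
    exact IsTree.single a
  | @node A B hA hB hlt hcol ihA ihB =>
    intro S hS hinj hmono hf
    have hsub : ∀ C ⊆ A ∪ B, (S.filter (g · ∈ C)).image g = C := by
      intro C hC
      ext b
      simp only [Finset.mem_image, Finset.mem_filter]
      constructor
      · rintro ⟨x, ⟨_, h⟩, rfl⟩; exact h
      · intro hb
        obtain ⟨x, hx, rfl⟩ := Finset.mem_image.1 (hS ▸ hC hb)
        exact ⟨x, ⟨hx, hb⟩, rfl⟩
    have hSAB : S = S.filter (g · ∈ A) ∪ S.filter (g · ∈ B) := by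
      rw [← Finset.filter_or]
      refine (Finset.filter_true_of_mem fun x hx => ?_).symm
      have := Finset.mem_image_of_mem g hx
      rw [hS] at this
      exact Finset.mem_union.1 this
    have hm : ∀ {C : Finset β} {x : α}, x ∈ S.filter (g · ∈ C) → x ∈ S ∧ g x ∈ C :=
      fun h => Finset.mem_filter.1 h
    have key : ∀ C ⊆ A ∪ B, ((∀ x ∈ S.filter (g · ∈ C), ∀ y ∈ S.filter (g · ∈ C), g x = g y → x = y) ∧
        (∀ x ∈ S.filter (g · ∈ C), ∀ y ∈ S.filter (g · ∈ C), g x < g y → x < y) ∧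
        (∀ x ∈ S.filter (g · ∈ C), ∀ y ∈ S.filter (g · ∈ C), ∀ x' ∈ S.filter (g · ∈ C),
          ∀ y' ∈ S.filter (g · ∈ C), x < y → x' < y' →
        f (g x) (g y) = f (g x') (g y') → f' x y = f' x' y')) := fun C _ =>
      ⟨fun x hx y hy => hinj x (hm hx).1 y (hm hy).1,
        fun x hx y hy => hmono x (hm hx).1 y (hm hy).1,
        fun x hx y hy x' hx' y' hy' => hf x (hm hx).1 y (hm hy).1 x' (hm hx').1 y' (hm hy').1⟩
    have kA := key A Finset.subset_union_left
    have kB := key B Finset.subset_union_right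
    have hlt' : ∀ a ∈ S.filter (g · ∈ A), ∀ b ∈ S.filter (g · ∈ B), a < b := fun a ha b hb =>
      hmono a (hm ha).1 b (hm hb).1 (hlt _ (hm ha).2 _ (hm hb).2)
    rw [hSAB]
    refine IsTree.node (ihA _ (hsub A Finset.subset_union_left) kA.1 kA.2.1 kA.2.2)
      (ihB _ (hsub B Finset.subset_union_right) kB.1 kB.2.1 kB.2.2) hlt' ?_
    intro a ha b hb a' ha' b' hb'
    exact hf a (hm ha).1 b (hm hb).1 a' (hm ha').1 b' (hm hb').1 (hlt' a ha b hb)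
      (hlt' a' ha' b' hb') (hcol _ (hm ha).2 _ (hm hb).2 _ (hm ha').2 _ (hm hb').2)

/-- If the coloring `f'` refines `f` along a strictly increasing map `g`, then it uses at least as
many colors on `S` as `f` does on the image of `S`; in the case of equality, tree structures lift. -/
theorem colors_refine {f : β → β → K} {f' : α → α → K'} {g : α → β} {S : Finset α} (π : K' → K)
    (hg : ∀ x ∈ S, ∀ y ∈ S, x < y → g x < g y)
    (hπ : ∀ x ∈ S, ∀ y ∈ S, x < y → f (g x) (g y) = π (f' x y)) :
    (colors f (S.image g)).card ≤ (colors f' S).card ∧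
      ((colors f' S).card ≤ (colors f (S.image g)).card → IsTree f (S.image g) → IsTree f' S) := by
  classical
  have hinj : ∀ x ∈ S, ∀ y ∈ S, g x = g y → x = y := by
    intro x hx y hy h
    rcases lt_trichotomy x y with h' | h' | h'
    · exact absurd h (hg x hx y hy h').ne
    · exact h'
    · exact absurd h.symm (hg y hy x hx h').ne
  have hmono : ∀ x ∈ S, ∀ y ∈ S, g x < g y → x < y := by
    intro x hx y hy h
    rcases lt_trichotomy x y with h' | h' | h'
    · exact h'
    · rw [h'] at h; exact absurd h (lt_irrefl _)
    · exact absurd h (hg y hy x hx h').not_gt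
  have him : colors f (S.image g) = (colors f' S).image π := by
    ext k
    rw [mem_colors, Finset.mem_image]
    constructor
    · rintro ⟨_, hx', _, hy', hxy, rfl⟩
      obtain ⟨x, hx, rfl⟩ := Finset.mem_image.1 hx'
      obtain ⟨y, hy, rfl⟩ := Finset.mem_image.1 hy'
      have := hmono x hx y hy hxy
      exact ⟨_, mem_colors_of hx hy this, (hπ x hx y hy this).symm⟩
    · rintro ⟨k, hk, rfl⟩
      obtain ⟨x, hx, y, hy, hxy, rfl⟩ := mem_colors.1 hk
      exact ⟨_, Finset.mem_image_of_mem g hx, _, Finset.mem_image_of_mem g hy, hg x hx y hy hxy,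
        hπ x hx y hy hxy⟩
  refine ⟨him ▸ Finset.card_image_le, fun hle ht => ?_⟩
  have hπinj : Set.InjOn π (colors f' S) :=
    Finset.card_image_iff.1 (le_antisymm Finset.card_image_le (him ▸ hle))
  refine ht.of_image S rfl hinj hmono ?_
  intro x hx y hy x' hx' y' hy' hxy hxy' h
  rw [hπ x hx y hy hxy, hπ x' hx' y' hy' hxy'] at h
  exact hπinj (mem_colors_of hx hy hxy) (mem_colors_of hx' hy' hxy') h

/-- A leaf of a tree may be replaced by two leaves that are joined in the same way to all others. -/
theorem IsTree.insert_twin {f : α → α → K} {S : Finset α} (hS : IsTree f S) (u v : α) (huv : u ≠ v)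
    (hv : v ∈ S)
    (h1 : ∀ z ∈ S, z < v → z < u ∧ f z u = f z v) (h2 : ∀ z ∈ S, v < z → u < z ∧ f u z = f v z) :
    IsTree f (insert u S) := by
  induction hS with
  | single a =>
    obtain rfl := Finset.mem_singleton.1 hv
    have key : ∀ x y : α, x < y → IsTree f ({x} ∪ {y}) := fun x y hxy =>
      IsTree.node (IsTree.single x) (IsTree.single y) (by simpa using hxy) (by simp)
    rcases huv.lt_or_gt with h | h
    · exact key _ _ h
    · have : insert u {v} = ({v} ∪ {u} : Finset α) := by ext; simp [or_comm]
      rw [this]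
      exact key _ _ h
  | @node A B hA hB hlt hcol ihA ihB =>
    rcases Finset.mem_union.1 hv with hv' | hv'
    · rw [← Finset.insert_union]
      refine IsTree.node (ihA hv' (fun z hz => h1 z (Finset.mem_union_left _ hz))
        (fun z hz => h2 z (Finset.mem_union_left _ hz))) hB ?_ ?_
      · intro a ha b hb
        rcases Finset.mem_insert.1 ha with rfl | ha
        · exact (h2 b (Finset.mem_union_right _ hb) (hlt v hv' b hb)).1
        · exact hlt a ha b hb
      · have : ∀ a ∈ insert u A, ∀ b ∈ B, ∃ a' ∈ A, f a b = f a' b := by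
          intro a ha b hb
          rcases Finset.mem_insert.1 ha with rfl | ha
          · exact ⟨v, hv', (h2 b (Finset.mem_union_right _ hb) (hlt v hv' b hb)).2⟩
          · exact ⟨a, ha, rfl⟩
        intro a ha b hb a' ha' b' hb'
        obtain ⟨c, hc, e⟩ := this a ha b hb
        obtain ⟨c', hc', e'⟩ := this a' ha' b' hb'
        rw [e, e']
        exact hcol c hc b hb c' hc' b' hb'
    · rw [← Finset.union_insert]
      refine IsTree.node hA (ihB hv' (fun z hz => h1 z (Finset.mem_union_right _ hz))
        (fun z hz => h2 z (Finset.mem_union_right _ hz))) ?_ ?_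
      · intro a ha b hb
        rcases Finset.mem_insert.1 hb with rfl | hb
        · exact (h1 a (Finset.mem_union_left _ ha) (hlt a ha v hv')).1
        · exact hlt a ha b hb
      · have : ∀ a ∈ A, ∀ b ∈ insert u B, ∃ b' ∈ B, f a b = f a b' := by
          intro a ha b hb
          rcases Finset.mem_insert.1 hb with rfl | hb
          · exact ⟨v, hv', (h1 a (Finset.mem_union_left _ ha) (hlt a ha v hv')).2⟩
          · exact ⟨b, hb, rfl⟩
        intro a ha b hb a' ha' b' hb'
        obtain ⟨c, hc, e⟩ := this a ha b hb
        obtain ⟨c', hc', e'⟩ := this a' ha' b' hb'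
        rw [e, e']
        exact hcol a ha c hc a' ha' c' hc'

/-- Sets of at most eight elements get at least as many colors as a tree on them has inner nodes,
and only trees get that few. -/
def IsTight (f : α → α → K) : Prop :=
  ∀ S : Finset α, S.Nonempty → S.card ≤ 8 →
    S.card ≤ (colors f S).card + 1 ∧ ((colors f S).card + 1 = S.card → IsTree f S)

/-- Three elements do not have a single color. -/
theorem IsTight.triangle {f : α → α → K} (hf : IsTight f) {x y z : α} (hxy : x < y) (hyz : y < z)
    (h : f x z = f x y) : f x y ≠ f y z := by
  classical
  intro h'
  have hc : ({x, y, z} : Finset α).card = 3 :=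
    Finset.card_eq_three.2 ⟨x, y, z, hxy.ne, (hxy.trans hyz).ne, hyz.ne, rfl⟩
  have h1 := (hf {x, y, z} ⟨x, by simp⟩ (by omega)).1
  have h2 : colors f {x, y, z} ⊆ {f x y} := by
    intro k hk
    obtain ⟨a, ha, b, hb, hab, rfl⟩ := mem_colors.1 hk
    simp only [Finset.mem_insert, Finset.mem_singleton] at ha hb ⊢
    have := hxy.trans hyz
    rcases ha with rfl | rfl | rfl <;> rcases hb with rfl | rfl | rfl <;>
      first | (exfalso; order) | simp_all
  have h3 := Finset.card_le_card h2
  rw [Finset.card_singleton] at h3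
  omega

/-- Two disjoint pairs joined by edges of one color have different colors. -/
theorem IsTight.pairs {f : α → α → K} (hf : IsTight f) {a b a' b' : α} (hab : a < b)
    (hab' : a' < b') (hlt : b < a') (h1 : f a b' = f a a') (h2 : f b a' = f a a')
    (h3 : f b b' = f a a') : f a b ≠ f a' b' := by
  classical
  intro h'
  have hc : ({a, b, a', b'} : Finset α).card = 4 := by
    rw [Finset.card_insert_of_notMem, Finset.card_insert_of_notMem, Finset.card_insert_of_notMem,
      Finset.card_singleton]
    · simp [hab'.ne]
    · simp [hlt.ne, (hlt.trans hab').ne]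
    · simp [hab.ne, (hab.trans hlt).ne, (hab.trans (hlt.trans hab')).ne]
  have h1 := (hf {a, b, a', b'} ⟨a, by simp⟩ (by omega)).1
  have h2 : colors f {a, b, a', b'} ⊆ {f a b, f a a'} := by
    intro k hk
    obtain ⟨x, hx, y, hy, hxy, rfl⟩ := mem_colors.1 hk
    simp only [Finset.mem_insert, Finset.mem_singleton] at hx hy ⊢
    rcases hx with rfl | rfl | rfl | rfl <;> rcases hy with rfl | rfl | rfl | rfl <;>
      first | (exfalso; order) | simp_all
  have h3 := (Finset.card_le_card h2).trans Finset.card_le_two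
  omega

end Trees

/-! ### Extension to lexicographic products -/

section Extension

/-- A coloring of ordered pairs whose colors determine the order type of the pair and the color of
the reversed pair, and for which no increasing path `u < v < w` is monochromatic. -/
structure IsPathColoring {V L : Type*} [LinearOrder V] (c : V → V → L) : Prop where
  lt_of_eq : ∀ {u v u' v'}, c u v = c u' v' → u < v → u' < v'
  swap : ∀ {u v u' v'}, c u v = c u' v' → c v u = c v' u'
  path : ∀ {u v w}, u < v → v < w → c u v ≠ c v w

namespace IsPathColoring

variable {V L : Type*} [LinearOrder V] {c : V → V → L}

theorem eq_of_eq (hc : IsPathColoring c) {u u' v' : V} (h : c u u = c u' v') : u' = v' := by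
  rcases lt_trichotomy u' v' with h' | h' | h'
  · exact absurd (hc.lt_of_eq h.symm h') (lt_irrefl _)
  · exact h'
  · exact absurd (hc.lt_of_eq (hc.swap h.symm) h') (lt_irrefl _)

theorem path' (hc : IsPathColoring c) {u v w : V} (huv : u < v) (hvw : v < w) : c w v ≠ c v u :=
  fun h => hc.path huv hvw (hc.swap h.symm)

theorem ne_swap (hc : IsPathColoring c) {u v u' v' : V} (h : u < v) (h' : u' < v') :
    c u v ≠ c v' u' :=
  fun e => (hc.lt_of_eq e h).not_gt h'

theorem ne_diag (hc : IsPathColoring c) {u v w : V} (h : u ≠ v) : c w w ≠ c u v :=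
  fun e => h (hc.eq_of_eq e)

open Classical in
theorem card_three (hc : IsPathColoring c) {u v : V} (h : u < v) :
    ({c u u, c u v, c v u} : Finset L).card = 3 :=
  Finset.card_eq_three.2 ⟨_, _, _, hc.ne_diag h.ne, hc.ne_diag h.ne', hc.ne_swap h h, rfl⟩

open Classical in
theorem card_five (hc : IsPathColoring c) {u v w z : V} (h : u < v) (h' : w < z)
    (hne : c u v ≠ c w z) :
    ({c u u, c u v, c v u, c w z, c z w} : Finset L).card = 5 := by
  have h1 := hc.ne_diag (w := u) h.ne
  have h2 := hc.ne_diag (w := u) h.ne'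
  have h3 := hc.ne_diag (w := u) h'.ne
  have h4 := hc.ne_diag (w := u) h'.ne'
  have h5 := hc.ne_swap h h
  have h6 := hc.ne_swap h h'
  have h7 := hc.ne_swap h' h
  have h8 := hc.ne_swap h' h'
  have h9 : c v u ≠ c z w := fun e => hne (hc.swap e)
  rw [Finset.card_insert_of_notMem, Finset.card_insert_of_notMem, Finset.card_insert_of_notMem,
    Finset.card_insert_of_notMem, Finset.card_singleton] <;> simp [*, h7.symm]

/-- A third element `b` is joined to one of `u`, `v` by a color that does not occur on `{u, v}`. -/
theorem exists_fresh (hc : IsPathColoring c) {u v b : V} (h : u < v) (hu : b ≠ u) (hv : b ≠ v) :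
    ∃ a, (a = u ∨ a = v) ∧ (c a b ≠ c u u ∧ c a b ≠ c u v ∧ c a b ≠ c v u) ∧
      (c b a ≠ c u u ∧ c b a ≠ c u v ∧ c b a ≠ c v u) := by
  have red : ∀ a, a ≠ b → c a b ≠ c u v → c a b ≠ c v u →
      (c a b ≠ c u u ∧ c a b ≠ c u v ∧ c a b ≠ c v u) ∧
      (c b a ≠ c u u ∧ c b a ≠ c u v ∧ c b a ≠ c v u) := fun a hab h1 h2 =>
    ⟨⟨(hc.ne_diag hab).symm, h1, h2⟩, (hc.ne_diag hab.symm).symm, fun e => h2 (hc.swap e),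
      fun e => h1 (hc.swap e)⟩
  rcases lt_or_gt_of_ne hu with hbu | hub
  · exact ⟨u, Or.inl rfl, red u hbu.ne' (hc.ne_swap h hbu).symm (hc.path' hbu h).symm⟩
  · rcases lt_or_gt_of_ne hv with hbv | hvb
    · by_cases e : c u b = c u v
      · refine ⟨v, Or.inr rfl, red v hbv.ne' (hc.ne_swap h hbv).symm fun e' => ?_⟩
        exact hc.path hub hbv (e.trans (hc.swap e').symm)
      · exact ⟨u, Or.inl rfl, red u hub.ne e (hc.ne_swap hub h)⟩
    · exact ⟨v, Or.inr rfl, red v hvb.ne (hc.path h hvb).symm (hc.ne_swap hvb h)⟩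

end IsPathColoring

variable {X V K L : Type*} [LinearOrder X]

/-- The extension of a coloring `f` of `X` to the lexicographic product `X ×ₗ V`: pairs that differ
in the first coordinate keep their color from `f`, to which the color under `c` of the second
coordinates is added; for all other pairs the second coordinates themselves are the color. -/
def extend (f : X → X → K) (c : V → V → L) (x y : X ×ₗ V) : (V × V) ⊕ (K × L) :=
  if (ofLex x).1 = (ofLex y).1 then Sum.inl ((ofLex x).2, (ofLex y).2)
  else Sum.inr (f (ofLex x).1 (ofLex y).1, c (ofLex x).2 (ofLex y).2)

variable {f : X → X → K} {c : V → V → L}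

theorem extend_eq (y : X) (u v : V) :
    extend f c (toLex (y, u)) (toLex (y, v)) = Sum.inl (u, v) := by
  simp [extend]

theorem extend_ne {y y' : X} (h : y ≠ y') (u v : V) :
    extend f c (toLex (y, u)) (toLex (y', v)) = Sum.inr (f y y', c u v) := by
  simp [extend, h]

theorem extend_of_fst_ne {x y : X ×ₗ V} (h : (ofLex x).1 ≠ (ofLex y).1) :
    extend f c x y = Sum.inr (f (ofLex x).1 (ofLex y).1, c (ofLex x).2 (ofLex y).2) := by
  simp [extend, h]

theorem fst_ne_of_extend_eq {x y x' y' : X ×ₗ V} (h : extend f c x y = extend f c x' y')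
    (hx : (ofLex x).1 ≠ (ofLex y).1) : (ofLex x').1 ≠ (ofLex y').1 ∧
      f (ofLex x).1 (ofLex y).1 = f (ofLex x').1 (ofLex y').1 := by
  rw [extend_of_fst_ne hx] at h
  by_cases h' : (ofLex x').1 = (ofLex y').1
  · simp [extend, h'] at h
  · rw [extend_of_fst_ne h'] at h
    simp only [Sum.inr.injEq, Prod.mk.injEq] at h
    exact ⟨h', h.1⟩

variable [LinearOrder V]

theorem fst_lt_of_lt {x y : X ×ₗ V} (h : x < y) (hne : (ofLex x).1 ≠ (ofLex y).1) :
    (ofLex x).1 < (ofLex y).1 := by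
  rcases Prod.Lex.lt_iff.1 h with h | h
  · exact h
  · exact absurd h.1 hne

theorem toLex_lt_of_fst {y y' : X} (h : y < y') (u v : V) : toLex (y, u) < toLex (y', v) :=
  Prod.Lex.lt_iff.2 (Or.inl h)

theorem toLex_lt_of_snd (y : X) {u v : V} (h : u < v) : toLex (y, u) < toLex (y, v) :=
  Prod.Lex.lt_iff.2 (Or.inr ⟨rfl, h⟩)

theorem inl_mem_colors {S : Finset (X ×ₗ V)} {u v : V} :
    Sum.inl (u, v) ∈ colors (extend f c) S ↔
      u < v ∧ ∃ y, toLex (y, u) ∈ S ∧ toLex (y, v) ∈ S := by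
  rw [mem_colors]
  constructor
  · rintro ⟨x, hx, y, hy, hxy, h⟩
    by_cases h' : (ofLex x).1 = (ofLex y).1
    · obtain ⟨x1, x2, rfl⟩ : ∃ a b, x = toLex (a, b) := ⟨_, _, rfl⟩
      obtain ⟨y1, y2, rfl⟩ : ∃ a b, y = toLex (a, b) := ⟨_, _, rfl⟩
      obtain rfl : x1 = y1 := h'
      rw [extend_eq] at h
      simp only [Sum.inl.injEq, Prod.mk.injEq] at h
      obtain ⟨rfl, rfl⟩ := h
      refine ⟨?_, x1, hx, hy⟩
      rcases Prod.Lex.lt_iff.1 hxy with h | h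
      · exact absurd h (lt_irrefl _)
      · exact h.2
    · rw [extend_of_fst_ne h'] at h
      simp at h
  · rintro ⟨huv, y, hu, hv⟩
    exact ⟨_, hu, _, hv, toLex_lt_of_snd y huv, extend_eq y u v⟩

theorem inr_mem_colors {S : Finset (X ×ₗ V)} {y y' : X} {u v : V} (h : y < y')
    (hu : toLex (y, u) ∈ S) (hv : toLex (y', v) ∈ S) :
    Sum.inr (f y y', c u v) ∈ colors (extend f c) S :=
  mem_colors.2 ⟨_, hu, _, hv, toLex_lt_of_fst h u v, extend_ne h.ne u v⟩

/-- In a tree for the extended coloring, the color in the first coordinate alone determines the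
color of a pair. -/
theorem IsTree.extend_eq_extend (hf : IsTight f) {S : Finset (X ×ₗ V)}
    (hS : IsTree (extend f c) S) : ∀ x ∈ S, ∀ y ∈ S, ∀ x' ∈ S, ∀ y' ∈ S, x < y → x' < y' →
      (ofLex x).1 ≠ (ofLex y).1 → (ofLex x').1 ≠ (ofLex y').1 →
      f (ofLex x).1 (ofLex y).1 = f (ofLex x').1 (ofLex y').1 →
      extend f c x y = extend f c x' y' := by
  induction hS with
  | single a =>
    intro x hx y hy
    rw [Finset.mem_singleton] at hx hy
    subst hx hy
    intro _ _ _ _ h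
    exact absurd h (lt_irrefl _)
  | @node A B hA hB hlt hcol ihA ihB =>
    -- A pair separated at the root and a pair inside a branch would give a triangle.
    have hcrossA : ∀ x ∈ A, ∀ y ∈ B, ∀ x' ∈ A, ∀ y' ∈ A, x' < y' →
        (ofLex x).1 ≠ (ofLex y).1 → (ofLex x').1 ≠ (ofLex y').1 →
        f (ofLex x).1 (ofLex y).1 ≠ f (ofLex x').1 (ofLex y').1 := by
      intro x hx y hy x' hx' y' hy' hlt' hne hne' e
      have h1 := fst_ne_of_extend_eq (hcol x hx y hy x' hx' y hy) hne
      have h2 := fst_ne_of_extend_eq (hcol x hx y hy y' hy' y hy) hne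
      exact hf.triangle (fst_lt_of_lt hlt' hne') (fst_lt_of_lt (hlt y' hy' y hy) h2.1)
        (h1.2.symm.trans e) (e.symm.trans h2.2)
    have hcrossB : ∀ x ∈ A, ∀ y ∈ B, ∀ x' ∈ B, ∀ y' ∈ B, x' < y' →
        (ofLex x).1 ≠ (ofLex y).1 → (ofLex x').1 ≠ (ofLex y').1 →
        f (ofLex x).1 (ofLex y).1 ≠ f (ofLex x').1 (ofLex y').1 := by
      intro x hx y hy x' hx' y' hy' hlt' hne hne' e
      have h1 := fst_ne_of_extend_eq (hcol x hx y hy x hx x' hx') hne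
      have h2 := fst_ne_of_extend_eq (hcol x hx y hy x hx y' hy') hne
      exact hf.triangle (fst_lt_of_lt (hlt x hx x' hx') h1.1) (fst_lt_of_lt hlt' hne')
        (h2.2.symm.trans h1.2) (h1.2.symm.trans e)
    have hpairs : ∀ x ∈ A, ∀ y ∈ A, ∀ x' ∈ B, ∀ y' ∈ B, x < y → x' < y' →
        (ofLex x).1 ≠ (ofLex y).1 → (ofLex x').1 ≠ (ofLex y').1 →
        f (ofLex x).1 (ofLex y).1 ≠ f (ofLex x').1 (ofLex y').1 := by
      intro x hx y hy x' hx' y' hy' hxy hxy' hne hne'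
      have h0 : (ofLex x).1 ≠ (ofLex x').1 := by
        intro h0
        have key : ∀ a ∈ A, ∀ b ∈ B, (ofLex a).1 = (ofLex b).1 := fun a ha b hb => by
          by_contra hab
          exact (fst_ne_of_extend_eq (hcol a ha b hb x hx x' hx') hab).1 h0
        exact hne ((key x hx x' hx').trans (key y hy x' hx').symm)
      have h1 := fst_ne_of_extend_eq (hcol x hx x' hx' x hx y' hy') h0
      have h2 := fst_ne_of_extend_eq (hcol x hx x' hx' y hy x' hx') h0
      have h3 := fst_ne_of_extend_eq (hcol x hx x' hx' y hy y' hy') h0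
      exact hf.pairs (fst_lt_of_lt hxy hne) (fst_lt_of_lt hxy' hne')
        (fst_lt_of_lt (hlt y hy x' hx') h2.1) h1.2.symm h2.2.symm h3.2.symm
    intro x hx y hy x' hx' y' hy' hxy hxy' hne hne' e
    rcases Finset.mem_union.1 hx with hx | hx <;> rcases Finset.mem_union.1 hy with hy | hy <;>
    rcases Finset.mem_union.1 hx' with hx' | hx' <;>
    rcases Finset.mem_union.1 hy' with hy' | hy' <;>
    first
    | exact ihA x hx y hy x' hx' y' hy' hxy hxy' hne hne' e
    | exact ihB x hx y hy x' hx' y' hy' hxy hxy' hne hne' e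
    | exact hcol x hx y hy x' hx' y' hy'
    | exact absurd hxy (hlt y hy x hx).not_gt
    | exact absurd hxy' (hlt y' hy' x' hx').not_gt
    | exact absurd e (hcrossA x hx y hy x' hx' y' hy' hxy' hne hne')
    | exact absurd e (hcrossB x hx y hy x' hx' y' hy' hxy' hne hne')
    | exact absurd e.symm (hcrossA x' hx' y' hy' x hx y hy hxy hne' hne)
    | exact absurd e.symm (hcrossB x' hx' y' hy' x hx y hy hxy hne' hne)
    | exact absurd e (hpairs x hx y hy x' hx' y' hy' hxy hxy' hne hne')
    | exact absurd e.symm (hpairs x' hx' y' hy' x hx y hy hxy' hxy hne' hne)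

/-- In a tree for the extended coloring, a fiber of the first coordinate with several elements
shares no second coordinate with another fiber. -/
theorem IsTree.not_shared (hc : IsPathColoring c) {S : Finset (X ×ₗ V)}
    (hS : IsTree (extend f c) S) {y y' : X} {u w : V} (hy : y ≠ y') (hu : u ≠ w)
    (hp : toLex (y, w) ∈ S) (hq : toLex (y', w) ∈ S) : toLex (y', u) ∉ S := by
  induction hS with
  | single a =>
    intro hr
    rw [Finset.mem_singleton] at hp hq
    have := hp.trans hq.symm
    simp only [EmbeddingLike.apply_eq_iff_eq, Prod.mk.injEq, and_true] at this
    exact hy this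
  | @node A B hA hB hlt hcol ihA ihB =>
    intro hr
    rcases Finset.mem_union.1 hp with hp | hp <;> rcases Finset.mem_union.1 hq with hq | hq <;>
    rcases Finset.mem_union.1 hr with hr | hr
    · exact ihA hp hq hr
    · have := hcol _ hp _ hr _ hq _ hr
      rw [extend_ne hy, extend_eq] at this
      cases this
    · have := hcol _ hp _ hq _ hr _ hq
      rw [extend_ne hy, extend_eq] at this
      cases this
    · have := hcol _ hp _ hq _ hp _ hr
      rw [extend_ne hy, extend_ne hy] at this
      simp only [Sum.inr.injEq, Prod.mk.injEq, true_and] at this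
      exact hc.ne_diag hu.symm this
    · have := hcol _ hq _ hp _ hr _ hp
      rw [extend_ne hy.symm, extend_ne hy.symm] at this
      simp only [Sum.inr.injEq, Prod.mk.injEq, true_and] at this
      exact hc.ne_diag hu this
    · have := hcol _ hq _ hp _ hq _ hr
      rw [extend_ne hy.symm, extend_eq] at this
      cases this
    · have := hcol _ hr _ hp _ hr _ hq
      rw [extend_ne hy.symm, extend_eq] at this
      cases this
    · exact ihB hp hq hr

/-- If two values `u`, `v` occur together in a single fiber only, then removing one of them loses a
color, and in the case of equality the removed element is a twin of the other one. -/
theorem card_le_of_unique_fiber (hf : IsTight f) (hc : IsPathColoring c) {S : Finset (X ×ₗ V)}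
    {y : X} {u v : V} (huv : u ≠ v) (hu : toLex (y, u) ∈ S) (hv : toLex (y, v) ∈ S)
    (huniq : ∀ y', toLex (y', u) ∈ S → toLex (y', v) ∈ S → y' = y)
    (ih : (S.erase (toLex (y, u))).card ≤ (colors (extend f c) (S.erase (toLex (y, u)))).card + 1 ∧
      ((colors (extend f c) (S.erase (toLex (y, u)))).card + 1 = (S.erase (toLex (y, u))).card →
        IsTree (extend f c) (S.erase (toLex (y, u))))) :
    S.card ≤ (colors (extend f c) S).card + 1 ∧
      ((colors (extend f c) S).card + 1 = S.card → IsTree (extend f c) S) := by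
  classical
  set S' := S.erase (toLex (y, u)) with hS'
  have hsub : S' ⊆ S := Finset.erase_subset _ _
  have hcard : S'.card + 1 = S.card := Finset.card_erase_add_one hu
  have hmin : ∀ (T : Finset (X ×ₗ V)) (z : X) (a b : V), a ≠ b → toLex (z, a) ∈ T →
      toLex (z, b) ∈ T → Sum.inl (min a b, max a b) ∈ colors (extend f c) T := by
    intro T z a b hab ha hb
    rcases hab.lt_or_gt with h | h
    · rw [min_eq_left h.le, max_eq_right h.le]; exact inl_mem_colors.2 ⟨h, z, ha, hb⟩
    · rw [min_eq_right h.le, max_eq_left h.le]; exact inl_mem_colors.2 ⟨h, z, hb, ha⟩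
  have hmin' : ∀ (T : Finset (X ×ₗ V)) (a b : V), Sum.inl (min a b, max a b) ∈
      colors (extend f c) T → ∃ z, toLex (z, a) ∈ T ∧ toLex (z, b) ∈ T := by
    intro T a b h
    obtain ⟨-, z, h1, h2⟩ := inl_mem_colors.1 h
    rcases le_total a b with h | h
    · rw [min_eq_left h] at h1; rw [max_eq_right h] at h2; exact ⟨z, h1, h2⟩
    · rw [min_eq_right h] at h1; rw [max_eq_left h] at h2; exact ⟨z, h2, h1⟩
  have hnew := hmin S y u v huv hu hv
  have hnew' : Sum.inl (min u v, max u v) ∉ colors (extend f c) S' := by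
    intro h
    obtain ⟨z, h1, h2⟩ := hmin' _ _ _ h
    have := huniq z (hsub h1) (hsub h2)
    subst this
    exact Finset.notMem_erase _ _ h1
  have hins : insert (Sum.inl (min u v, max u v)) (colors (extend f c) S') ⊆
      colors (extend f c) S :=
    Finset.insert_subset hnew (colors_mono _ hsub)
  have hle := Finset.card_le_card hins
  rw [Finset.card_insert_of_notMem hnew'] at hle
  refine ⟨by omega, fun heq => ?_⟩
  have htree := ih.2 (by omega)
  have hCeq := Finset.eq_of_subset_of_card_le hins (by
    rw [Finset.card_insert_of_notMem hnew']; omega)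
  have hv' : toLex (y, v) ∈ S' := Finset.mem_erase.2 ⟨by simpa using huv.symm, hv⟩
  -- The fiber of `u` and `v` has no third element.
  have hfib : ∀ w, toLex (y, w) ∈ S' → w = v := by
    intro w hw
    by_contra hwv
    have hwu : w ≠ u := by
      rintro rfl; exact Finset.notMem_erase _ _ hw
    have hmem := hmin S y w u hwu (hsub hw) hu
    rw [← hCeq, Finset.mem_insert] at hmem
    rcases hmem with h | h
    · have h' : Sum.inl (min w u, max w u) ∈
          colors (extend f c) {toLex (y, u), toLex (y, v)} := by
        rw [h]; exact hmin _ y u v huv (by simp) (by simp)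
      obtain ⟨z, h1, -⟩ := hmin' _ _ _ h'
      simp [hwu, hwv] at h1
    · obtain ⟨z, h1, h2⟩ := hmin' _ _ _ h
      have hyz : y ≠ z := by
        rintro rfl; exact Finset.notMem_erase _ _ h2
      exact htree.not_shared hc hyz hwu.symm hw h1 h2
  have hold : ∀ k, Sum.inr k ∈ colors (extend f c) S →
      ∃ g ∈ S', ∃ h ∈ S', g < h ∧ extend f c g h = Sum.inr k := by
    intro k hk
    rw [← hCeq, Finset.mem_insert] at hk
    rcases hk with hk | hk
    · cases hk
    · exact mem_colors.1 hk
  have hinr : ∀ {g h : X ×ₗ V} {k : K × L}, extend f c g h = Sum.inr k →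
      (ofLex g).1 ≠ (ofLex h).1 ∧ f (ofLex g).1 (ofLex h).1 = k.1 := by
    intro g h k e
    by_cases h' : (ofLex g).1 = (ofLex h).1
    · simp [extend, h'] at e
    · rw [extend_of_fst_ne h'] at e
      simp only [Sum.inr.injEq] at e
      exact ⟨h', by rw [← e]⟩
  rw [← Finset.insert_erase hu]
  refine htree.insert_twin _ _ (by simpa using huv) hv' ?_ ?_
  · intro z hz hlt
    obtain ⟨z1, w, rfl⟩ : ∃ a b, z = toLex (a, b) := ⟨_, _, rfl⟩
    have hne : z1 ≠ y := by
      rintro rfl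
      obtain rfl := hfib w hz
      exact lt_irrefl _ hlt
    have hz1 : z1 < y := fst_lt_of_lt hlt hne
    refine ⟨toLex_lt_of_fst hz1 _ _, ?_⟩
    obtain ⟨g, hg, h, hh, hgh, e⟩ := hold _ (inr_mem_colors (f := f) (c := c) hz1 (hsub hz) hu)
    rw [extend_ne hne w u, ← e]
    exact htree.extend_eq_extend hf _ hg _ hh _ hz _ hv' hgh hlt (hinr e).1 hne (hinr e).2
  · intro z hz hlt
    obtain ⟨z1, w, rfl⟩ : ∃ a b, z = toLex (a, b) := ⟨_, _, rfl⟩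
    have hne : y ≠ z1 := by
      rintro rfl
      obtain rfl := hfib w hz
      exact lt_irrefl _ hlt
    have hz1 : y < z1 := fst_lt_of_lt hlt hne
    refine ⟨toLex_lt_of_fst hz1 _ _, ?_⟩
    obtain ⟨g, hg, h, hh, hgh, e⟩ := hold _ (inr_mem_colors (f := f) (c := c) hz1 hu (hsub hz))
    rw [extend_ne hne u w, ← e]
    exact htree.extend_eq_extend hf _ hg _ hh _ hv' _ hz hgh hlt (hinr e).1 hne (hinr e).2

end Extension

/-! ### Counting the colors of an extension -/

section Counting

theorem card_add_mul_le {K L : Type*} [DecidableEq K] [DecidableEq L] {I : Finset (K × L)}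
    {P G : Finset K} {D : Finset L} (hP : P ⊆ I.image Prod.fst) (hG : G ⊆ P) (hD : D.Nonempty)
    (hGD : G ×ˢ D ⊆ I) : P.card + G.card * (D.card - 1) ≤ I.card := by
  have h1 : G.card * D.card ≤ (I.filter (·.1 ∈ G)).card := by
    rw [← Finset.card_product]
    refine Finset.card_le_card fun x hx => Finset.mem_filter.2 ⟨hGD hx, (Finset.mem_product.1 hx).1⟩
  have h2 : (P \ G).card ≤ (I.filter (¬ ·.1 ∈ G)).card := by
    refine le_trans (Finset.card_le_card ?_) (Finset.card_image_le (f := Prod.fst))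
    intro k hk
    obtain ⟨hk, hkG⟩ := Finset.mem_sdiff.1 hk
    obtain ⟨x, hx, rfl⟩ := Finset.mem_image.1 (hP hk)
    exact Finset.mem_image.2 ⟨x, Finset.mem_filter.2 ⟨hx, hkG⟩, rfl⟩
  have h3 := Finset.card_filter_add_card_filter_not (s := I) (·.1 ∈ G)
  have h4 := Finset.card_sdiff_add_card_eq_card hG
  have h5 : G.card * (D.card - 1) + G.card = G.card * D.card := by
    obtain ⟨d, hd⟩ : ∃ d, D.card = d + 1 := ⟨D.card - 1, by have := hD.card_pos; omega⟩
    rw [hd]; simp; ring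
  omega

variable {X V K L : Type*} [LinearOrder X] [LinearOrder V] {f : X → X → K} {c : V → V → L}

/-- Two pairs of a tree that have the same color are joined by an edge of that color. -/
theorem IsTree.exists_cross (hf : IsTight f) {S : Finset X} (hS : IsTree f S) :
    ∀ a ∈ S, ∀ b ∈ S, ∀ a' ∈ S, ∀ b' ∈ S, a < b → a' < b' → f a b = f a' b' →
      ∃ x, (x = a ∨ x = b) ∧ ∃ x', (x' = a' ∨ x' = b') ∧
        (x < x' ∧ f x x' = f a b ∨ x' < x ∧ f x' x = f a b) := by
  induction hS with
  | single a =>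
    intro x hx y hy
    rw [Finset.mem_singleton] at hx hy
    subst hx hy
    intro _ _ _ _ h
    exact absurd h (lt_irrefl _)
  | @node A B hA hB hlt hcol ihA ihB =>
    intro a ha b hb a' ha' b' hb' hab hab' e
    rcases Finset.mem_union.1 ha with ha | ha <;> rcases Finset.mem_union.1 hb with hb | hb <;>
    rcases Finset.mem_union.1 ha' with ha' | ha' <;>
    rcases Finset.mem_union.1 hb' with hb' | hb' <;>
    first
    | exact ihA a ha b hb a' ha' b' hb' hab hab' e
    | exact ihB a ha b hb a' ha' b' hb' hab hab' e
    | exact absurd hab (hlt b hb a ha).not_gt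
    | exact absurd hab' (hlt b' hb' a' ha').not_gt
    | exact absurd e (hf.pairs hab hab' (hlt b hb a' ha') (hcol a ha b' hb' a ha a' ha')
        (hcol b hb a' ha' a ha a' ha') (hcol b hb b' hb' a ha a' ha'))
    | exact absurd e.symm (hf.pairs hab' hab (hlt b' hb' a ha) (hcol a' ha' b hb a' ha' a ha)
        (hcol b' hb' a ha a' ha' a ha) (hcol b' hb' b hb a' ha' a ha))
    | exact ⟨a, Or.inl rfl, b', Or.inr rfl, Or.inl ⟨hlt a ha b' hb',
        (hcol a ha b' hb' a' ha' b' hb').trans e.symm⟩⟩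
    | exact ⟨a, Or.inl rfl, b', Or.inr rfl, Or.inl ⟨hlt a ha b' hb', hcol a ha b' hb' a ha b hb⟩⟩
    | exact ⟨b, Or.inr rfl, a', Or.inl rfl, Or.inr ⟨hlt a' ha' b hb, hcol a' ha' b hb a ha b hb⟩⟩
    | exact ⟨a, Or.inl rfl, a', Or.inl rfl, Or.inl ⟨hlt a ha a' ha', hcol a ha a' ha' a ha b hb⟩⟩
    | exact ⟨b, Or.inr rfl, a', Or.inl rfl, Or.inr ⟨hlt a' ha' b hb,
        (hcol a' ha' b hb a' ha' b' hb').trans e.symm⟩⟩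

open Classical in
/-- Lower bound for the number of colors of the extended coloring on `S`, from sets `J` of colors
inside the fibers, `P` of colors in the first coordinate, and combinations of `G` and `D`. -/
theorem card_colors_extend_ge {S : Finset (X ×ₗ V)} {J : Finset (V × V)} {P G : Finset K}
    {D : Finset L} (hJ : ∀ p ∈ J, Sum.inl p ∈ colors (extend f c) S)
    (hP : ∀ k ∈ P, ∃ l, Sum.inr (k, l) ∈ colors (extend f c) S) (hG : G ⊆ P) (hD : D.Nonempty)
    (hGD : ∀ k ∈ G, ∀ l ∈ D, Sum.inr (k, l) ∈ colors (extend f c) S) :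
    J.card + (P.card + G.card * (D.card - 1)) ≤ (colors (extend f c) S).card := by
  rw [← Finset.card_toLeft_add_card_toRight (u := colors (extend f c) S)]
  refine Nat.add_le_add (Finset.card_le_card fun p hp => Finset.mem_toLeft.2 (hJ p hp))
    (card_add_mul_le (fun k hk => ?_) hG hD fun x hx => ?_)
  · obtain ⟨l, hl⟩ := hP k hk
    exact Finset.mem_image.2 ⟨_, Finset.mem_toRight.2 hl, rfl⟩
  · obtain ⟨h1, h2⟩ := Finset.mem_product.1 hx
    exact Finset.mem_toRight.2 (hGD _ h1 _ h2)

theorem exists_inr_mem {S : Finset (X ×ₗ V)} {Y : Finset X}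
    (hY : ∀ y ∈ Y, ∃ a, toLex (y, a) ∈ S) :
    ∀ k ∈ colors f Y, ∃ l, Sum.inr (k, l) ∈ colors (extend f c) S := by
  intro k hk
  obtain ⟨y, hy, y', hy', hlt, rfl⟩ := mem_colors.1 hk
  obtain ⟨a, ha⟩ := hY y hy
  obtain ⟨b, hb⟩ := hY y' hy'
  exact ⟨_, inr_mem_colors hlt ha hb⟩

open Classical in
theorem mem_three_colors {S : Finset (X ×ₗ V)} {y y' : X} {u v : V} (h : y < y')
    (hu : toLex (y, u) ∈ S) (hv : toLex (y, v) ∈ S) (hu' : toLex (y', u) ∈ S)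
    (hv' : toLex (y', v) ∈ S) : ∀ l ∈ ({c u u, c u v, c v u} : Finset L),
      Sum.inr (f y y', l) ∈ colors (extend f c) S := by
  intro l hl
  simp only [Finset.mem_insert, Finset.mem_singleton] at hl
  rcases hl with rfl | rfl | rfl <;> exact inr_mem_colors h (by assumption) (by assumption)

/-- Two fibers that have three values in common force eight colors. -/
theorem eight_le_of_triple (hc : IsPathColoring c) {S : Finset (X ×ₗ V)}
    {y y' : X} (hy : y < y') {u v w : V} (huv : u < v) (hvw : v < w)
    (hS : ∀ z, z = y ∨ z = y' → ∀ a, a = u ∨ a = v ∨ a = w → toLex (z, a) ∈ S) :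
    8 ≤ (colors (extend f c) S).card := by
  classical
  have hJ : ({(u, v), (v, w), (u, w)} : Finset (V × V)).card = 3 :=
    Finset.card_eq_three.2 ⟨_, _, _, by simp [huv.ne], by simp [hvw.ne], by simp [huv.ne'], rfl⟩
  have hD := hc.card_five huv hvw (hc.path huv hvw)
  have h := card_colors_extend_ge (f := f) (c := c) (S := S)
    (J := {(u, v), (v, w), (u, w)}) (P := {f y y'}) (G := {f y y'})
    (D := {c u u, c u v, c v u, c v w, c w v}) ?_ ?_ subset_rfl (by simp) ?_
  · rw [hJ, hD] at h
    simpa using h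
  · intro p hp
    simp only [Finset.mem_insert, Finset.mem_singleton] at hp
    rcases hp with rfl | rfl | rfl
    · exact inl_mem_colors.2 ⟨huv, y, hS _ (by simp) _ (by simp), hS _ (by simp) _ (by simp)⟩
    · exact inl_mem_colors.2 ⟨hvw, y, hS _ (by simp) _ (by simp), hS _ (by simp) _ (by simp)⟩
    · exact inl_mem_colors.2 ⟨huv.trans hvw, y, hS _ (by simp) _ (by simp),
        hS _ (by simp) _ (by simp)⟩
  · intro k hk
    rw [Finset.mem_singleton.1 hk]
    exact ⟨_, inr_mem_colors hy (hS _ (by simp) u (by simp)) (hS _ (by simp) u (by simp))⟩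
  · intro k hk l hl
    rw [Finset.mem_singleton.1 hk]
    simp only [Finset.mem_insert, Finset.mem_singleton] at hl
    rcases hl with rfl | rfl | rfl | rfl | rfl <;>
      exact inr_mem_colors hy (hS _ (by simp) _ (by simp)) (hS _ (by simp) _ (by simp))

/-- If every pair of values in a fiber occurs in a second fiber, then, as there are at most eight
elements, every triple of values in a fiber occurs in a second fiber. -/
theorem exists_fiber_triple {S : Finset (X ×ₗ V)} (hS : S.card ≤ 8)
    (hdouble : ∀ y u v, u ≠ v → toLex (y, u) ∈ S → toLex (y, v) ∈ S →
      ∃ y' ≠ y, toLex (y', u) ∈ S ∧ toLex (y', v) ∈ S)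
    {y : X} {a b d : V} (hab : a ≠ b) (hbd : b ≠ d) (had : a ≠ d) (ha : toLex (y, a) ∈ S)
    (hb : toLex (y, b) ∈ S) (hd : toLex (y, d) ∈ S) :
    ∃ y' ≠ y, toLex (y', a) ∈ S ∧ toLex (y', b) ∈ S ∧ toLex (y', d) ∈ S := by
  classical
  by_contra hcon
  push Not at hcon
  obtain ⟨y1, h1, h1a, h1b⟩ := hdouble y a b hab ha hb
  obtain ⟨y2, h2, h2a, h2d⟩ := hdouble y a d had ha hd
  obtain ⟨y3, h3, h3b, h3d⟩ := hdouble y b d hbd hb hd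
  have h12 : y1 ≠ y2 := by rintro rfl; exact hcon _ h1 h1a h1b h2d
  have h13 : y1 ≠ y3 := by rintro rfl; exact hcon _ h1 h1a h1b h3d
  have h23 : y2 ≠ y3 := by rintro rfl; exact hcon _ h2 h2a h3b h2d
  have hcard : (({(y, a), (y, b), (y, d), (y1, a), (y1, b), (y2, a), (y2, d), (y3, b), (y3, d)} :
      Finset (X × V)).image toLex).card = 9 := by
    rw [Finset.card_image_of_injective _ toLex.injective]
    have := h1.symm
    have := h2.symm
    have := h3.symm
    simp [*]
  have hsub : (({(y, a), (y, b), (y, d), (y1, a), (y1, b), (y2, a), (y2, d), (y3, b), (y3, d)} :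
      Finset (X × V)).image toLex) ⊆ S := by
    intro x hx
    simp only [Finset.mem_image, Finset.mem_insert, Finset.mem_singleton] at hx
    obtain ⟨p, hp, rfl⟩ := hx
    rcases hp with rfl | rfl | rfl | rfl | rfl | rfl | rfl | rfl | rfl <;> assumption
  have := Finset.card_le_card hsub
  omega

/-- The case that all fibers with more than one element consist of the same two values. -/
theorem card_le_of_single_pair (hf : IsTight f) (hc : IsPathColoring c) {S : Finset (X ×ₗ V)}
    (hS : S.card ≤ 8) {u v : V} (huv : u < v)
    (honly : ∀ y a b, a < b → toLex (y, a) ∈ S → toLex (y, b) ∈ S → a = u ∧ b = v)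
    {y0 y1 : X} (h01 : y0 ≠ y1) (h0u : toLex (y0, u) ∈ S) (h0v : toLex (y0, v) ∈ S)
    (h1u : toLex (y1, u) ∈ S) (h1v : toLex (y1, v) ∈ S) :
    S.card ≤ (colors (extend f c) S).card := by
  classical
  set B : Finset X := S.image fun x => (ofLex x).1 with hB
  have hmB : ∀ y, y ∈ B ↔ ∃ a, toLex (y, a) ∈ S := by
    intro y
    simp only [hB, Finset.mem_image]
    constructor
    · rintro ⟨x, hx, rfl⟩; exact ⟨(ofLex x).2, hx⟩
    · rintro ⟨a, ha⟩; exact ⟨_, ha, rfl⟩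
  set Y : Finset X := B.filter fun y => toLex (y, u) ∈ S ∧ toLex (y, v) ∈ S with hY
  have hmY : ∀ y, y ∈ Y ↔ toLex (y, u) ∈ S ∧ toLex (y, v) ∈ S := by
    intro y
    rw [hY, Finset.mem_filter, hmB]
    exact ⟨fun h => h.2, fun h => ⟨⟨u, h.1⟩, h⟩⟩
  have hYB : Y ⊆ B := Finset.filter_subset _ _
  -- Every fiber has one element, and those over `Y` have one more.
  have hScard : S.card ≤ B.card + Y.card := by
    rw [← Finset.card_filter_add_card_filter_not (s := S)
      fun x => ¬ ((ofLex x).2 = v ∧ toLex ((ofLex x).1, u) ∈ S)]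
    refine Nat.add_le_add (Finset.card_le_card_of_injOn (fun x => (ofLex x).1) ?_ ?_)
      (Finset.card_le_card_of_injOn (fun x => (ofLex x).1) ?_ ?_)
    · intro x hx
      exact Finset.mem_coe.2 (Finset.mem_image_of_mem _ (Finset.mem_filter.1 hx).1)
    · intro x hx x' hx' e
      obtain ⟨y, a, rfl⟩ : ∃ y a, x = toLex (y, a) := ⟨_, _, rfl⟩
      obtain ⟨y', a', rfl⟩ : ∃ y a, x' = toLex (y, a) := ⟨_, _, rfl⟩
      obtain rfl : y = y' := e
      simp only [Finset.coe_filter, Set.mem_ofPred_eq, ofLex_toLex, not_and] at hx hx'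
      rcases lt_trichotomy a a' with h | h | h
      · obtain ⟨rfl, rfl⟩ := honly y a a' h hx.1 hx'.1
        exact absurd hx.1 (hx'.2 rfl)
      · rw [h]
      · obtain ⟨rfl, rfl⟩ := honly y a' a h hx'.1 hx.1
        exact absurd hx'.1 (hx.2 rfl)
    · intro x hx
      simp only [Finset.coe_filter, Set.mem_ofPred_eq, not_not] at hx
      refine Finset.mem_coe.2 ((hmY _).2 ⟨hx.2.2, ?_⟩)
      rw [← hx.2.1]
      exact hx.1
    · intro x hx x' hx' e
      simp only [Finset.coe_filter, Set.mem_ofPred_eq, not_not] at hx hx'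
      exact ofLex.injective (Prod.ext e (hx.2.1.trans hx'.2.1.symm))
  have h0Y := (hmY y0).2 ⟨h0u, h0v⟩
  have h1Y := (hmY y1).2 ⟨h1u, h1v⟩
  have hY2 : 2 ≤ Y.card := Finset.one_lt_card.2 ⟨y0, h0Y, y1, h1Y, h01⟩
  have hB8 : B.card ≤ 8 := Finset.card_image_le.trans hS
  have hYB' := Finset.card_le_card hYB
  have hfB := (hf B ⟨y0, hYB h0Y⟩ hB8).1
  have hfY := (hf Y ⟨y0, h0Y⟩ (by omega)).1
  have h := card_colors_extend_ge (f := f) (c := c) (S := S) (J := {(u, v)}) (P := colors f B)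
    (G := colors f Y) (D := {c u u, c u v, c v u}) ?_ (exists_inr_mem fun y hy => (hmB y).1 hy)
    (colors_mono f hYB) (by simp) ?_
  · rw [hc.card_three huv, Finset.card_singleton] at h
    omega
  · intro p hp
    rw [Finset.mem_singleton.1 hp]
    exact inl_mem_colors.2 ⟨huv, y0, h0u, h0v⟩
  · intro k hk
    obtain ⟨y, hy, y', hy', hlt, rfl⟩ := mem_colors.1 hk
    rw [hmY] at hy hy'
    exact mem_three_colors hlt hy.1 hy.2 hy'.1 hy'.2

/-- Two different pairs of values, each of which occurs in two fibers, the four fibers being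
different, force eight colors. -/
theorem eight_le_of_two_pairs (hf : IsTight f) (hc : IsPathColoring c) {S : Finset (X ×ₗ V)}
    {u v w z : V} (huv : u < v) (hwz : w < z) (hne : ¬ (w = u ∧ z = v)) {y0 y1 y2 y3 : X}
    (h01 : y0 < y1) (h23 : y2 < y3) (h02 : y0 ≠ y2) (h03 : y0 ≠ y3) (h12 : y1 ≠ y2) (h13 : y1 ≠ y3)
    (hS : ∀ y, y = y0 ∨ y = y1 → ∀ a, a = u ∨ a = v → toLex (y, a) ∈ S)
    (hS' : ∀ y, y = y2 ∨ y = y3 → ∀ a, a = w ∨ a = z → toLex (y, a) ∈ S) :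
    8 ≤ (colors (extend f c) S).card := by
  classical
  -- Two colors come from inside the fibers; the task is to find six colors between them. There are
  -- at least three colors in the first coordinate, and at least three colors above `f y0 y1`.
  have hJ : ({(u, v), (w, z)} : Finset (V × V)).card = 2 := by
    refine Finset.card_pair fun e => ?_
    simp only [Prod.mk.injEq] at e
    exact hne ⟨e.1.symm, e.2.symm⟩
  have hJmem : ∀ p ∈ ({(u, v), (w, z)} : Finset (V × V)),
      Sum.inl p ∈ colors (extend f c) S := by
    intro p hp
    simp only [Finset.mem_insert, Finset.mem_singleton] at hp
    rcases hp with rfl | rfl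
    · exact inl_mem_colors.2 ⟨huv, y0, hS _ (by simp) _ (by simp), hS _ (by simp) _ (by simp)⟩
    · exact inl_mem_colors.2 ⟨hwz, y2, hS' _ (by simp) _ (by simp), hS' _ (by simp) _ (by simp)⟩
  have hD01 := mem_three_colors (f := f) (c := c) h01 (hS y0 (by simp) u (by simp))
    (hS y0 (by simp) v (by simp)) (hS y1 (by simp) u (by simp)) (hS y1 (by simp) v (by simp))
  have hD23 := mem_three_colors (f := f) (c := c) h23 (hS' y2 (by simp) w (by simp))
    (hS' y2 (by simp) z (by simp)) (hS' y3 (by simp) w (by simp)) (hS' y3 (by simp) z (by simp))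
  set Y : Finset X := {y0, y1, y2, y3} with hY
  have hYcard : Y.card = 4 := by
    rw [hY, Finset.card_insert_of_notMem, Finset.card_insert_of_notMem,
      Finset.card_insert_of_notMem, Finset.card_singleton]
    · simp [h23.ne]
    · simp [h12, h13]
    · simp [h01.ne, h02, h03]
  have hYS : ∀ y ∈ Y, ∃ a, toLex (y, a) ∈ S := by
    intro y hy
    simp only [hY, Finset.mem_insert, Finset.mem_singleton] at hy
    rcases hy with rfl | rfl | rfl | rfl
    exacts [⟨u, hS _ (by simp) _ (by simp)⟩, ⟨u, hS _ (by simp) _ (by simp)⟩,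
      ⟨w, hS' _ (by simp) _ (by simp)⟩, ⟨w, hS' _ (by simp) _ (by simp)⟩]
  have hfY := hf Y ⟨y0, by simp [hY]⟩ (by omega)
  rw [hYcard] at hfY
  have m01 : f y0 y1 ∈ colors f Y := mem_colors_of (by simp [hY]) (by simp [hY]) h01
  have m23 : f y2 y3 ∈ colors f Y := mem_colors_of (by simp [hY]) (by simp [hY]) h23
  by_cases hα : f y0 y1 = f y2 y3
  · have hP := exists_inr_mem (f := f) (c := c) hYS
    by_cases hκ : c u v = c w z
    · by_cases h4 : 4 ≤ (colors f Y).card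
      · have h := card_colors_extend_ge (D := {c u u, c u v, c v u}) hJmem hP
          (Finset.singleton_subset_iff.2 m01) (by simp) (by
            intro k hk l hl
            rw [Finset.mem_singleton.1 hk]
            exact hD01 l hl)
        rw [hJ, hc.card_three huv, Finset.card_singleton] at h
        omega
      · -- Now the four fibers form a tree, so that the color also joins the two pairs of fibers.
        obtain ⟨x, hx, x', hx', hxx⟩ := (hfY.2 (by omega)).exists_cross hf y0 (by simp [hY])
          y1 (by simp [hY]) y2 (by simp [hY]) y3 (by simp [hY]) h01 h23 hα
        obtain ⟨b, hb, hbu, hbv⟩ : ∃ b, (b = w ∨ b = z) ∧ b ≠ u ∧ b ≠ v := by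
          by_cases hw : w ≠ u ∧ w ≠ v
          · exact ⟨w, Or.inl rfl, hw⟩
          · refine ⟨z, Or.inr rfl, ?_, ?_⟩
            · rintro rfl
              exact hw ⟨hwz.ne, (hwz.trans huv).ne⟩
            · rintro rfl
              exact hw ⟨fun e => hne ⟨e, rfl⟩, hwz.ne⟩
        obtain ⟨a, ha, n1, n2⟩ := hc.exists_fresh huv hbu hbv
        obtain ⟨l, hl, hlD⟩ : ∃ l, Sum.inr (f y0 y1, l) ∈ colors (extend f c) S ∧
            l ∉ ({c u u, c u v, c v u} : Finset L) := by
          rcases hxx with ⟨hlt, e⟩ | ⟨hlt, e⟩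
          · exact ⟨c a b, e ▸ inr_mem_colors hlt (hS x hx a ha) (hS' x' hx' b hb), by simpa using n1⟩
          · exact ⟨c b a, e ▸ inr_mem_colors hlt (hS' x' hx' b hb) (hS x hx a ha), by simpa using n2⟩
        have h := card_colors_extend_ge (D := insert l {c u u, c u v, c v u}) hJmem hP
          (Finset.singleton_subset_iff.2 m01) (by simp) (by
            intro k hk l' hl'
            rw [Finset.mem_singleton.1 hk]
            rcases Finset.mem_insert.1 hl' with rfl | hl'
            · exact hl
            · exact hD01 l' hl')
        rw [hJ, Finset.card_insert_of_notMem hlD, hc.card_three huv, Finset.card_singleton] at h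
        omega
    · have h := card_colors_extend_ge (D := {c u u, c u v, c v u, c w z, c z w}) hJmem hP
        (Finset.singleton_subset_iff.2 m01) (by simp) (by
          intro k hk l hl
          rw [Finset.mem_singleton.1 hk]
          simp only [Finset.mem_insert, Finset.mem_singleton] at hl hD01 hD23
          rcases hl with h | h | h | h | h
          · exact hD01 l (by simp [h])
          · exact hD01 l (by simp [h])
          · exact hD01 l (by simp [h])
          · exact hα ▸ hD23 l (by simp [h])
          · exact hα ▸ hD23 l (by simp [h]))
      rw [hJ, hc.card_five huv hwz hκ, Finset.card_singleton] at h
      omega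
  · rw [← Finset.card_toLeft_add_card_toRight (u := colors (extend f c) S)]
    have h1 : 2 ≤ (colors (extend f c) S).toLeft.card :=
      hJ ▸ Finset.card_le_card fun p hp => Finset.mem_toLeft.2 (hJmem p hp)
    have h2 : (({f y0 y1} : Finset K) ×ˢ ({c u u, c u v, c v u} : Finset L) ∪
        ({f y2 y3} : Finset K) ×ˢ ({c w w, c w z, c z w} : Finset L)).card ≤
        (colors (extend f c) S).toRight.card := by
      refine Finset.card_le_card fun p hp => Finset.mem_toRight.2 ?_
      obtain ⟨k, l⟩ := p
      rcases Finset.mem_union.1 hp with hp | hp <;> obtain ⟨hk, hl⟩ := Finset.mem_product.1 hp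
      · obtain rfl : k = f y0 y1 := Finset.mem_singleton.1 hk
        exact hD01 l hl
      · obtain rfl : k = f y2 y3 := Finset.mem_singleton.1 hk
        exact hD23 l hl
    rw [Finset.card_union_of_disjoint, Finset.card_product, Finset.card_product,
      Finset.card_singleton, Finset.card_singleton, hc.card_three huv, hc.card_three hwz] at h2
    · omega
    · refine Finset.disjoint_left.2 fun p hp hp' => hα ?_
      exact (Finset.mem_singleton.1 (Finset.mem_product.1 hp).1).symm.trans
        (Finset.mem_singleton.1 (Finset.mem_product.1 hp').1)

/-- If some fiber has two elements and every pair of values in a fiber occurs in a second fiber,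
then there are too many colors for a tree. -/
theorem card_le_of_double_fibers (hf : IsTight f) (hc : IsPathColoring c) {S : Finset (X ×ₗ V)}
    (hS : S.card ≤ 8) (hdouble : ∀ y u v, u ≠ v → toLex (y, u) ∈ S → toLex (y, v) ∈ S →
      ∃ y' ≠ y, toLex (y', u) ∈ S ∧ toLex (y', v) ∈ S)
    {y0 : X} {u v : V} (huv : u < v) (h0u : toLex (y0, u) ∈ S) (h0v : toLex (y0, v) ∈ S) :
    S.card ≤ (colors (extend f c) S).card := by
  by_cases h3 : ∃ y a b d, a < b ∧ b < d ∧ toLex (y, a) ∈ S ∧ toLex (y, b) ∈ S ∧ toLex (y, d) ∈ S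
  · obtain ⟨y, a, b, d, hab, hbd, ha, hb, hd⟩ := h3
    obtain ⟨y', hy', ha', hb', hd'⟩ := exists_fiber_triple hS hdouble hab.ne hbd.ne
      (hab.trans hbd).ne ha hb hd
    refine hS.trans ?_
    rcases hy'.lt_or_gt with h | h
    · refine eight_le_of_triple hc h hab hbd ?_
      rintro z (rfl | rfl) x (rfl | rfl | rfl) <;> assumption
    · refine eight_le_of_triple hc h hab hbd ?_
      rintro z (rfl | rfl) x (rfl | rfl | rfl) <;> assumption
  -- All fibers have at most two elements.
  have hfib : ∀ y a b d, a < b → toLex (y, a) ∈ S → toLex (y, b) ∈ S → toLex (y, d) ∈ S →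
      d = a ∨ d = b := by
    intro y a b d hab ha hb hd
    by_contra hcon
    push Not at hcon
    rcases hcon.1.lt_or_gt with h | h
    · exact h3 ⟨y, d, a, b, h, hab, hd, ha, hb⟩
    · rcases hcon.2.lt_or_gt with h' | h'
      · exact h3 ⟨y, a, d, b, h, h', ha, hd, hb⟩
      · exact h3 ⟨y, a, b, d, hab, h', ha, hb, hd⟩
  obtain ⟨y1, h10, h1u, h1v⟩ := hdouble y0 u v huv.ne h0u h0v
  by_cases honly : ∀ y a b, a < b → toLex (y, a) ∈ S → toLex (y, b) ∈ S → a = u ∧ b = v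
  · exact card_le_of_single_pair hf hc hS huv honly h10.symm h0u h0v h1u h1v
  · push Not at honly
    obtain ⟨y2, w, z, hwz, h2w, h2z, hne⟩ := honly
    have hne' : ¬ (w = u ∧ z = v) := fun h => hne h.1 h.2
    obtain ⟨y3, h32, h3w, h3z⟩ := hdouble y2 w z hwz.ne h2w h2z
    have hdisj : ∀ y, toLex (y, u) ∈ S → toLex (y, v) ∈ S → toLex (y, w) ∈ S →
        toLex (y, z) ∉ S := by
      intro y hu hv hw hz
      rcases hfib y u v w huv hu hv hw with rfl | rfl
      · rcases hfib y w v z huv hu hv hz with rfl | rfl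
        · exact lt_irrefl _ hwz
        · exact hne' ⟨rfl, rfl⟩
      · rcases hfib y u w z huv hu hv hz with rfl | rfl
        · exact lt_asymm huv hwz
        · exact lt_irrefl _ hwz
    have key : ∀ p q r s : X, p < q → r < s → (∀ y, y = p ∨ y = q → y = y0 ∨ y = y1) →
        (∀ y, y = r ∨ y = s → y = y2 ∨ y = y3) → 8 ≤ (colors (extend f c) S).card := by
      intro p q r s hpq hrs h1 h2
      have m1 : ∀ y, y = p ∨ y = q → ∀ a, a = u ∨ a = v → toLex (y, a) ∈ S := by
        intro y hy a ha
        rcases h1 y hy with rfl | rfl <;> rcases ha with rfl | rfl <;> assumption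
      have m2 : ∀ y, y = r ∨ y = s → ∀ a, a = w ∨ a = z → toLex (y, a) ∈ S := by
        intro y hy a ha
        rcases h2 y hy with rfl | rfl <;> rcases ha with rfl | rfl <;> assumption
      have hd : ∀ y y', (y = p ∨ y = q) → (y' = r ∨ y' = s) → y ≠ y' := by
        rintro y _ hy hy' rfl
        exact hdisj y (m1 y hy u (by simp)) (m1 y hy v (by simp)) (m2 y hy' w (by simp))
          (m2 y hy' z (by simp))
      exact eight_le_of_two_pairs hf hc huv hwz hne' hpq hrs (hd _ _ (by simp) (by simp))
        (hd _ _ (by simp) (by simp)) (hd _ _ (by simp) (by simp)) (hd _ _ (by simp) (by simp)) m1 m2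
    refine hS.trans ?_
    rcases h10.lt_or_gt with h | h <;> rcases h32.lt_or_gt with h' | h' <;>
      refine key _ _ _ _ h h' ?_ ?_ <;> tauto

/-- Extension to a lexicographic product preserves tightness. This follows by induction on `S`:
either the first coordinate is injective on `S`, or two values occur together in one fiber only, and
one of them may be removed, or `S` has many colors. -/
theorem IsTight.extend (hf : IsTight f) (hc : IsPathColoring c) :
    IsTight (extend f c) := by
  classical
  intro S
  induction hn : S.card using Nat.strong_induction_on generalizing S with
  | _ n ih =>
  subst hn
  intro hne h8
  by_cases hinj : ∀ y u v, u < v → toLex (y, u) ∈ S → toLex (y, v) ∉ S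
  · set g : X ×ₗ V → X := fun x => (ofLex x).1 with hg
    have hfst : ∀ x ∈ S, ∀ y ∈ S, x < y → g x ≠ g y := by
      intro x hx y hy hxy e
      obtain ⟨x1, a, rfl⟩ : ∃ x1 a, x = toLex (x1, a) := ⟨_, _, rfl⟩
      obtain ⟨y1, b, rfl⟩ : ∃ y1 b, y = toLex (y1, b) := ⟨_, _, rfl⟩
      obtain rfl : x1 = y1 := e
      rcases Prod.Lex.lt_iff.1 hxy with h | h
      · exact lt_irrefl _ h
      · exact hinj x1 a b h.2 hx hy
    have hmono : ∀ x ∈ S, ∀ y ∈ S, x < y → g x < g y := fun x hx y hy hxy =>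
      fst_lt_of_lt hxy (hfst x hx y hy hxy)
    obtain ⟨x0, hx0⟩ := hne
    have href := colors_refine (f := f) (f' := ErdosGyarfas.extend f c) (g := g) (S := S)
      (Sum.elim (fun _ => f (g x0) (g x0)) Prod.fst) hmono (by
        intro x hx y hy hxy
        rw [extend_of_fst_ne (hfst x hx y hy hxy)]
        rfl)
    have hcard : (S.image g).card = S.card := by
      refine Finset.card_image_of_injOn ?_
      intro x hx y hy e
      rcases lt_trichotomy x y with h | h | h
      · exact absurd e (hmono x hx y hy h).ne
      · exact h
      · exact absurd e (hmono y hy x hx h).ne'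
    have h := hf (S.image g) ⟨_, Finset.mem_image_of_mem g hx0⟩ (by omega)
    rw [hcard] at h
    exact ⟨by omega, fun e => href.2 (by omega) (h.2 (by omega))⟩
  · push Not at hinj
    obtain ⟨y0, u, v, huv, h0u, h0v⟩ := hinj
    by_cases huniq : ∃ y a b, a ≠ b ∧ toLex (y, a) ∈ S ∧ toLex (y, b) ∈ S ∧
        ∀ y', toLex (y', a) ∈ S → toLex (y', b) ∈ S → y' = y
    · obtain ⟨y, a, b, hab, ha, hb, hu⟩ := huniq
      have hlt : (S.erase (toLex (y, a))).card < S.card := Finset.card_erase_lt_of_mem ha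
      refine card_le_of_unique_fiber hf hc hab ha hb hu
        (ih _ hlt _ rfl ⟨toLex (y, b), Finset.mem_erase.2 ⟨by simpa using hab.symm, hb⟩⟩ (by omega))
    · push Not at huniq
      have := card_le_of_double_fibers hf hc h8 (fun y a b hab ha hb => by
        obtain ⟨y', h1, h2, h3⟩ := huniq y a b hab ha hb
        exact ⟨y', h3, h1, h2⟩) huv h0u h0v
      exact ⟨by omega, fun e => by omega⟩

end Counting

/-! ### Tight colorings with few colors -/

section Construction

/-- For distinct binary words of length `m`, the first place of difference, together with the two
bits there, is a path coloring: if `u < v < w`, then `v` cannot have both the larger bit against `u`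
and the smaller bit against `w` in one place. -/
theorem exists_isPathColoring (m : ℕ) :
    ∃ (V : Type) (_ : LinearOrder V) (_ : Fintype V) (L : Type) (_ : Fintype L) (c : V → V → L),
      IsPathColoring c ∧ Fintype.card V = 2 ^ m ∧ Fintype.card L = 4 * m + 1 := by
  induction m with
  | zero =>
    refine ⟨Unit, inferInstance, inferInstance, Unit, inferInstance, fun _ _ => (),
      ⟨fun _ h => absurd h (lt_irrefl _), fun _ => rfl, fun h => absurd h (lt_irrefl _)⟩, ?_, ?_⟩ <;>
      simp
  | succ m ih =>
    obtain ⟨V, iV, fV, L, fL, c, hc, hV, hL⟩ := ih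
    -- Split every element in two; new pairs are colored by their values in `Bool`.
    let c' : V ×ₗ Bool → V ×ₗ Bool → L ⊕ (Bool × Bool) := fun x y =>
      if (ofLex x).1 = (ofLex y).1 then Sum.inr ((ofLex x).2, (ofLex y).2)
      else Sum.inl (c (ofLex x).1 (ofLex y).1)
    have key : ∀ {x y x' y'}, c' x y = c' x' y' →
        ((ofLex x).1 = (ofLex y).1 ∧ (ofLex x').1 = (ofLex y').1 ∧ (ofLex x).2 = (ofLex x').2 ∧
          (ofLex y).2 = (ofLex y').2) ∨
        ((ofLex x).1 ≠ (ofLex y).1 ∧ (ofLex x').1 ≠ (ofLex y').1 ∧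
          c (ofLex x).1 (ofLex y).1 = c (ofLex x').1 (ofLex y').1) := by
      intro x y x' y' h
      simp only [c'] at h
      split_ifs at h with h1 h2 h2
      · simp only [Sum.inr.injEq, Prod.mk.injEq] at h
        exact Or.inl ⟨h1, h2, h⟩
      · simp only [Sum.inl.injEq] at h
        exact Or.inr ⟨h1, h2, h⟩
    refine ⟨V ×ₗ Bool, inferInstance, inferInstanceAs (Fintype (V × Bool)), L ⊕ (Bool × Bool),
      inferInstance, c', ⟨?_, ?_, ?_⟩, ?_, ?_⟩
    · intro x y x' y' h hlt
      rcases key h with ⟨h1, h2, h3, h4⟩ | ⟨h1, h2, h3⟩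
      · rcases Prod.Lex.lt_iff.1 hlt with h' | h'
        · exact absurd h1 h'.ne
        · exact Prod.Lex.lt_iff.2 (Or.inr ⟨h2, by rw [← h3, ← h4]; exact h'.2⟩)
      · exact Prod.Lex.lt_iff.2 (Or.inl (hc.lt_of_eq h3 (fst_lt_of_lt hlt h1)))
    · intro x y x' y' h
      rcases key h with ⟨h1, h2, h3, h4⟩ | ⟨h1, h2, h3⟩
      · simp [c', h1, h2, h3, h4]
      · simp [c', h1.symm, h2.symm, hc.swap h3]
    · intro x y z hxy hyz h
      rcases key h with ⟨h1, h2, h3, h4⟩ | ⟨h1, h2, h3⟩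
      · rcases Prod.Lex.lt_iff.1 hxy with h' | h'
        · exact h'.ne h1
        · exact h'.2.ne h3
      · exact hc.path (fst_lt_of_lt hxy h1) (fst_lt_of_lt hyz h2) h3
    · change Fintype.card (V × Bool) = _
      rw [Fintype.card_prod, hV, Fintype.card_bool, pow_succ]
    · simp only [Fintype.card_sum, hL, Fintype.card_prod, Fintype.card_bool]
      ring

/-- A coloring of a set of `2 ^ (m * t)` elements, with few colors if `m` and `t` are about equal,
for which small sets with few colors are trees. -/
theorem exists_isTight (m t : ℕ) :
    ∃ (X : Type) (_ : LinearOrder X) (_ : Fintype X) (K : Type) (_ : Fintype K) (f : X → X → K),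
      IsTight f ∧ Fintype.card X = 2 ^ (m * t) ∧
      Fintype.card K ≤ (t + 1) * 4 ^ m * (4 * m + 1) ^ t := by
  obtain ⟨V, iV, fV, L, fL, c, hc, hV, hL⟩ := exists_isPathColoring m
  induction t with
  | zero =>
    refine ⟨Unit, inferInstance, inferInstance, Unit, inferInstance, fun _ _ => (), ?_, by simp, ?_⟩
    · intro S hS _
      have hS1 : S.card = 1 := le_antisymm (by simpa using S.card_le_univ) hS.card_pos
      obtain ⟨a, rfl⟩ := Finset.card_eq_one.1 hS1
      exact ⟨by simp, fun _ => IsTree.single a⟩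
    · simpa using Nat.one_le_pow _ _ (by norm_num)
  | succ t ih =>
    obtain ⟨X, iX, fX, K, fK, f, hf, hX, hK⟩ := ih
    refine ⟨X ×ₗ V, inferInstance, inferInstanceAs (Fintype (X × V)), (V × V) ⊕ (K × L),
      inferInstance, extend f c, hf.extend hc, ?_, ?_⟩
    · change Fintype.card (X × V) = _
      rw [Fintype.card_prod, hX, hV, ← pow_add, Nat.mul_succ]
    · simp only [Fintype.card_sum, Fintype.card_prod, hV, hL]
      have h1 : 2 ^ m * 2 ^ m = 4 ^ m := by
        rw [← mul_pow]; norm_num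
      have h2 := Nat.mul_le_mul_right (4 * m + 1) hK
      have h3 : 1 ≤ (4 * m + 1) ^ (t + 1) := Nat.one_le_pow _ _ (by omega)
      have h4 := Nat.mul_le_mul_left (4 ^ m) h3
      calc _ ≤ 4 ^ m * (4 * m + 1) ^ (t + 1) +
            (t + 1) * 4 ^ m * (4 * m + 1) ^ t * (4 * m + 1) := by rw [h1]; omega
        _ = _ := by ring

end Construction

/-! ### The dot product coloring -/

section DotProduct

open Module

variable {F : Type*} [Field F] {d : ℕ}

open Classical in
/-- The dot product coloring of `F ^ d`. The color of `(x, y)` records which of the equations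
`x ⬝ᵥ y = 0`, `x ⬝ᵥ y = x ⬝ᵥ x`, `x ⬝ᵥ y = y ⬝ᵥ y` hold. If none does, then it also records
`x ⬝ᵥ y`; otherwise it records a coordinate in which `x` and `y` differ, and the difference. The
value at `x = y` is irrelevant. -/
noncomputable def dotColor (x y : Fin d → F) : (Prop × Prop × Prop) × (F ⊕ (Fin d × F)) :=
  ((x ⬝ᵥ y = 0, x ⬝ᵥ y = x ⬝ᵥ x, x ⬝ᵥ y = y ⬝ᵥ y),
    if x ⬝ᵥ y = 0 ∨ x ⬝ᵥ y = x ⬝ᵥ x ∨ x ⬝ᵥ y = y ⬝ᵥ y then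
      if h : ∃ i, x i ≠ y i then Sum.inr (h.choose, y h.choose - x h.choose) else Sum.inl 0
    else Sum.inl (x ⬝ᵥ y))

theorem dotColor_snd (x y : Fin d → F) (hxy : x ≠ y) :
    (x ⬝ᵥ y = 0 ∨ x ⬝ᵥ y = x ⬝ᵥ x ∨ x ⬝ᵥ y = y ⬝ᵥ y) ∧
        (∃ i, x i ≠ y i ∧ (dotColor x y).2 = Sum.inr (i, y i - x i)) ∨
      (x ⬝ᵥ y ≠ 0 ∧ x ⬝ᵥ y ≠ x ⬝ᵥ x ∧ x ⬝ᵥ y ≠ y ⬝ᵥ y) ∧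
        (dotColor x y).2 = Sum.inl (x ⬝ᵥ y) := by
  by_cases h : x ⬝ᵥ y = 0 ∨ x ⬝ᵥ y = x ⬝ᵥ x ∨ x ⬝ᵥ y = y ⬝ᵥ y
  · have h' : ∃ i, x i ≠ y i := Function.ne_iff.1 hxy
    refine Or.inl ⟨h, h'.choose, h'.choose_spec, ?_⟩
    simp only [dotColor]
    rw [if_pos h, dif_pos h']
  · refine Or.inr ⟨by simpa [not_or] using h, ?_⟩
    simp only [dotColor]
    rw [if_neg h]

theorem finrank_add_finrank_le_of_orthogonal {U W : Submodule F (Fin d → F)}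
    (h : ∀ u ∈ U, ∀ w ∈ W, u ⬝ᵥ w = 0) : finrank F U + finrank F W ≤ d := by
  have h1 := Subspace.finrank_add_finrank_dualCoannihilator_eq
    (U.map (dotProductEquiv F (Fin d)).toLinearMap)
  rw [LinearEquiv.finrank_map_eq, finrank_fin_fun] at h1
  have h2 : W ≤ (U.map (dotProductEquiv F (Fin d)).toLinearMap).dualCoannihilator := by
    intro w hw
    rw [Submodule.mem_dualCoannihilator]
    intro φ hφ
    obtain ⟨u, hu, rfl⟩ := Submodule.mem_map.1 hφ
    exact h u hu w hw
  have := Submodule.finrank_mono h2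
  omega

/-- The dimension of the affine span of a set. -/
noncomputable def affineRank (s : Set (Fin d → F)) : ℕ := finrank F (vectorSpan F s)

theorem affineRank_le (s : Set (Fin d → F)) : affineRank s ≤ d :=
  (Submodule.finrank_le _).trans_eq (finrank_fin_fun F)

theorem vectorSpan_le_ker {s : Set (Fin d → F)} {ℓ : (Fin d → F) →ₗ[F] F}
    (h : ∀ x ∈ s, ∀ y ∈ s, ℓ x = ℓ y) : vectorSpan F s ≤ LinearMap.ker ℓ := by
  rw [vectorSpan_def, Submodule.span_le]
  rintro _ ⟨x, hx, y, hy, rfl⟩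
  simp [h x hx y hy]

theorem affineRank_lt {s t : Set (Fin d → F)} (hst : s ⊆ t) {ℓ : (Fin d → F) →ₗ[F] F}
    (h : ∀ x ∈ s, ∀ y ∈ s, ℓ x = ℓ y) {a b : Fin d → F} (ha : a ∈ t) (hb : b ∈ s)
    (hab : ℓ a ≠ ℓ b) : affineRank s < affineRank t := by
  refine Submodule.finrank_lt_finrank_of_lt (lt_of_le_of_ne (vectorSpan_mono F hst) fun e => hab ?_)
  have h1 : a -ᵥ b ∈ vectorSpan F t := vsub_mem_vectorSpan F ha (hst hb)
  rw [← e] at h1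
  have := vectorSpan_le_ker h h1
  rw [LinearMap.mem_ker, vsub_eq_sub, map_sub, sub_eq_zero] at this
  exact this

/-- If the affine span of `s` avoids the origin and the linear span of `s` is orthogonal to the
directions of `t`, then the dimensions are bounded. -/
theorem affineRank_add_lt {s t : Set (Fin d → F)} {ℓ : (Fin d → F) →ₗ[F] F}
    (h : ∀ x ∈ s, ∀ y ∈ s, ℓ x = ℓ y) {a : Fin d → F} (ha : a ∈ s) (ha0 : ℓ a ≠ 0)
    (horth : ∀ x ∈ s, ∀ y ∈ t, ∀ y' ∈ t, x ⬝ᵥ y = x ⬝ᵥ y') :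
    affineRank s + affineRank t < d := by
  have h1 : affineRank s < finrank F (Submodule.span F s) := by
    refine Submodule.finrank_lt_finrank_of_lt (lt_of_le_of_ne ?_ fun e => ha0 ?_)
    · rw [vectorSpan_def, Submodule.span_le]
      rintro _ ⟨x, hx, y, hy, rfl⟩
      exact Submodule.sub_mem _ (Submodule.subset_span hx) (Submodule.subset_span hy)
    · have h1 : a ∈ Submodule.span F s := Submodule.subset_span ha
      rw [← e] at h1
      exact vectorSpan_le_ker h h1
  have h2 : finrank F (Submodule.span F s) + affineRank t ≤ d := by
    refine finrank_add_finrank_le_of_orthogonal fun u hu w hw => ?_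
    have hs : ∀ x ∈ s, x ⬝ᵥ w = 0 := fun x hx =>
      vectorSpan_le_ker (ℓ := dotProductEquiv F (Fin d) x) (fun y hy y' hy' => horth x hx y hy y' hy')
        hw
    induction hu using Submodule.span_induction with
    | mem x hx => exact hs x hx
    | zero => exact zero_dotProduct w
    | add x y _ _ hx hy => rw [add_dotProduct, hx, hy, add_zero]
    | smul c x _ hx => rw [smul_dotProduct, hx, smul_zero]
  omega

/-- If all pairs in `s × t` have the same color, then the affine spans of `s` and of `t` have
smaller dimension than that of the union, and the sum of their dimensions is less than `d`. -/
theorem affineRank_of_dotColor_eq {s t : Set (Fin d → F)} (hs0 : ∀ x ∈ s, ∀ i, x i ≠ 0)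
    (ht0 : ∀ x ∈ t, ∀ i, x i ≠ 0) (hst : ∀ x ∈ s, ∀ y ∈ t, x ≠ y)
    (hcol : ∀ x ∈ s, ∀ y ∈ t, ∀ x' ∈ s, ∀ y' ∈ t, dotColor x y = dotColor x' y')
    (hs : s.Nonempty) (ht : t.Nonempty) :
    affineRank s < affineRank (s ∪ t) ∧ affineRank t < affineRank (s ∪ t) ∧
      affineRank s + affineRank t < d := by
  obtain ⟨a, ha⟩ := hs
  obtain ⟨b, hb⟩ := ht
  have hflag : ∀ x ∈ s, ∀ y ∈ t, (x ⬝ᵥ y = 0 ↔ a ⬝ᵥ b = 0) ∧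
      (x ⬝ᵥ y = x ⬝ᵥ x ↔ a ⬝ᵥ b = a ⬝ᵥ a) ∧ (x ⬝ᵥ y = y ⬝ᵥ y ↔ a ⬝ᵥ b = b ⬝ᵥ b) := by
    intro x hx y hy
    have h := congrArg Prod.fst (hcol x hx y hy a ha b hb)
    simp only [dotColor, Prod.mk.injEq] at h
    exact ⟨iff_of_eq h.1, iff_of_eq h.2.1, iff_of_eq h.2.2⟩
  have hl : ∀ u x : Fin d → F, dotProductEquiv F (Fin d) u x = u ⬝ᵥ x := fun _ _ => rfl
  rcases dotColor_snd a b (hst a ha b hb) with ⟨hflags, i, hi, hai⟩ | ⟨⟨n1, n2, n3⟩, hab⟩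
  · -- The coordinate `i` is constant on `s` and on `t`, with different non-zero values.
    have hdiff : ∀ x ∈ s, ∀ y ∈ t, y i - x i = b i - a i := by
      intro x hx y hy
      have h := hcol x hx y hy a ha b hb
      rcases dotColor_snd x y (hst x hx y hy) with ⟨-, j, -, hj⟩ | ⟨-, hj⟩
      · rw [h, hai] at hj
        simp only [Sum.inr.injEq, Prod.mk.injEq] at hj
        obtain ⟨rfl, hj⟩ := hj
        exact hj.symm
      · rw [h, hai] at hj
        cases hj
    have hsi : ∀ x ∈ s, ∀ y ∈ s, x i = y i := by
      intro x hx y hy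
      linear_combination hdiff y hy b hb - hdiff x hx b hb
    have hti : ∀ x ∈ t, ∀ y ∈ t, x i = y i := by
      intro x hx y hy
      linear_combination hdiff a ha x hx - hdiff a ha y hy
    refine ⟨affineRank_lt (ℓ := LinearMap.proj i) Set.subset_union_left hsi (Or.inr hb) ha hi.symm,
      affineRank_lt (ℓ := LinearMap.proj i) Set.subset_union_right hti (Or.inl ha) hb hi, ?_⟩
    rcases hflags with h | h | h
    · refine affineRank_add_lt (ℓ := LinearMap.proj i) hsi ha (hs0 a ha i) fun x hx y hy y' hy' => ?_
      rw [(hflag x hx y hy).1.2 h, (hflag x hx y' hy').1.2 h]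
    · refine affineRank_add_lt (ℓ := LinearMap.proj i) hsi ha (hs0 a ha i) fun x hx y hy y' hy' => ?_
      rw [(hflag x hx y hy).2.1.2 h, (hflag x hx y' hy').2.1.2 h]
    · rw [add_comm]
      refine affineRank_add_lt (ℓ := LinearMap.proj i) hti hb (ht0 b hb i) fun y hy x hx x' hx' => ?_
      rw [dotProduct_comm y x, dotProduct_comm y x', (hflag x hx y hy).2.2.2 h,
        (hflag x' hx' y hy).2.2.2 h]
  · have hval : ∀ x ∈ s, ∀ y ∈ t, x ⬝ᵥ y = a ⬝ᵥ b := by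
      intro x hx y hy
      have h := hcol x hx y hy a ha b hb
      rcases dotColor_snd x y (hst x hx y hy) with ⟨-, j, -, hj⟩ | ⟨-, hj⟩
      · rw [h, hab] at hj
        cases hj
      · rw [h, hab] at hj
        simpa using hj.symm
    have hsb : ∀ x ∈ s, ∀ y ∈ s,
        dotProductEquiv F (Fin d) b x = dotProductEquiv F (Fin d) b y := by
      intro x hx y hy
      rw [hl, hl, dotProduct_comm b x, hval x hx b hb, dotProduct_comm b y, hval y hy b hb]
    refine ⟨affineRank_lt Set.subset_union_left hsb (Or.inr hb) ha ?_,
      affineRank_lt (ℓ := dotProductEquiv F (Fin d) a) Set.subset_union_right ?_ (Or.inl ha) hb ?_,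
      affineRank_add_lt hsb ha ?_ ?_⟩
    · rw [hl, hl, dotProduct_comm b a]; exact n3.symm
    · intro x hx y hy
      rw [hl, hl, hval a ha x hx, hval a ha y hy]
    · rw [hl, hl]; exact n2.symm
    · rw [hl, dotProduct_comm]; exact n1
    · intro x hx y hy y' hy'
      rw [hval x hx y hy, hval x hx y' hy']

/-- Trees for the dot product coloring in dimension at most four are small. -/
theorem card_le_of_isTree_dotColor {α : Type*} [LinearOrder α] {ψ : α → Fin d → F}
    (hψ : Function.Injective ψ) (hψ0 : ∀ a i, ψ a i ≠ 0) (hd : d ≤ 4) {S : Finset α}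
    (hS : IsTree (fun a b => dotColor (ψ a) (ψ b)) S) : S.card ≤ 7 ∧ (d = 3 → S.card ≤ 5) := by
  -- For affine dimension 0, 1, 2, 3 there are at most 1, 2, 4, 6 leaves: the dimensions of the
  -- branches are smaller and have sum at most `d - 1`, so that the bound 6 arises as 2 + 4 and, for
  -- `d = 4`, the bound 7 as 1 + 6; for `d = 3` the largest sum is 1 + 4.
  suffices h : (affineRank (ψ '' S) = 0 → S.card ≤ 1) ∧ (affineRank (ψ '' S) ≤ 1 → S.card ≤ 2) ∧
      (affineRank (ψ '' S) ≤ 2 → S.card ≤ 4) ∧ (affineRank (ψ '' S) ≤ 3 → S.card ≤ 6) ∧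
      S.card ≤ 7 ∧ (d = 3 → S.card ≤ 5) from h.2.2.2.2
  induction hS with
  | single a => simp
  | @node A B hA hB hlt hcol ihA ihB =>
    have h := affineRank_of_dotColor_eq (s := ψ '' A) (t := ψ '' B)
      (by rintro _ ⟨a, -, rfl⟩; exact hψ0 a) (by rintro _ ⟨a, -, rfl⟩; exact hψ0 a)
      (by
        rintro _ ⟨a, ha, rfl⟩ _ ⟨b, hb, rfl⟩ e
        exact (hlt a ha b hb).ne (hψ e))
      (by
        rintro _ ⟨a, ha, rfl⟩ _ ⟨b, hb, rfl⟩ _ ⟨a', ha', rfl⟩ _ ⟨b', hb', rfl⟩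
        exact hcol a ha b hb a' ha' b' hb')
      (hA.nonempty.to_set.image ψ) (hB.nonempty.to_set.image ψ)
    have hr := affineRank_le (ψ '' (A ∪ B : Finset α))
    rw [Finset.coe_union, Set.image_union] at hr ⊢
    have hc := Finset.card_union_le A B
    omega

theorem card_dotColor {F : Type*} [Fintype F] :
    Fintype.card ((Prop × Prop × Prop) × (F ⊕ (Fin d × F))) = 8 * (d + 1) * Fintype.card F := by
  simp only [Fintype.card_prod, Fintype.card_prop, Fintype.card_sum, Fintype.card_fin]
  ring

end DotProduct

/-! ### The upper bound -/

section Upper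

theorem IsTree.comp {α K K' : Type*} [LinearOrder α] {f : α → α → K} (π : K → K') {S : Finset α}
    (hS : IsTree f S) : IsTree (fun x y => π (f x y)) S := by
  induction hS with
  | single a => exact IsTree.single a
  | node _ _ hlt hcol ihA ihB =>
    exact IsTree.node ihA ihB hlt fun a ha b hb a' ha' b' hb' =>
      congrArg π (hcol a ha b hb a' ha' b' hb')

/-- A function on the pairs `x < y` of a finite order that has enough colors on all `p`-subsets
bounds the Erdős–Gyárfás function. -/
theorem erdosGyarfas_le_card {n p q : ℕ} {K : Type*} [Fintype K] (g : Fin n → Fin n → K)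
    (hg : ∀ S : Finset (Fin n), S.card = p → q ≤ (colors g S).card) :
    erdosGyarfas n p q ≤ Fintype.card K := by
  classical
  let κ := Fintype.equivFin K
  let C : SimpleGraph.TopEdgeLabeling (Fin n) (Fin (Fintype.card K)) :=
    SimpleGraph.EdgeLabeling.mk (fun x y _ => κ (g (min x y) (max x y)))
      (fun x y _ => by rw [min_comm, max_comm])
  refine Nat.sInf_le ⟨C, fun S hS => ?_⟩
  have hsub : (((colors g S).image κ : Finset _) : Set (Fin (Fintype.card K))) ⊆
      colorsOn C S := by
    intro _ hκ
    obtain ⟨k, hk, rfl⟩ := Finset.mem_image.1 (Finset.mem_coe.1 hκ)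
    obtain ⟨x, hx, y, hy, hxy, rfl⟩ := mem_colors.1 hk
    refine ⟨x, hx, y, hy, hxy.ne, ?_⟩
    rw [SimpleGraph.EdgeLabeling.get_mk, min_eq_left hxy.le, max_eq_right hxy.le]
  refine le_trans ?_ (Set.encard_le_encard hsub)
  rw [Set.encard_coe_eq_coe_finsetCard, Finset.card_image_of_injective _ κ.injective]
  exact_mod_cast hg S hS.card_eq

/-- The combination of a tight coloring and the dot product coloring is a `(p,p)`-coloring: a set
of `p` vertices with fewer than `p` colors would be a tree for both, hence small. -/
theorem erdosGyarfas_le {d p n m q : ℕ} (hq : q.Prime) (hp8 : p ≤ 8) (hd : d ≤ 4)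
    (hp : 7 < p ∨ d = 3 ∧ 5 < p) (hn : n ≤ (q - 1) ^ d) (hnm : n ≤ 2 ^ (m * m)) :
    erdosGyarfas n p p ≤ (m + 1) * 4 ^ m * (4 * m + 1) ^ m * (8 * (d + 1) * q) := by
  classical
  have := Fact.mk hq
  obtain ⟨X, iX, fX, K, fK, f, hf, hX, hK⟩ := exists_isTight m m
  -- Vectors without zero coordinates are functions into the group of units.
  obtain ⟨ψ⟩ : Nonempty (Fin n ↪ (Fin d → (ZMod q)ˣ)) := by
    refine Function.Embedding.nonempty_of_card_le ?_
    simpa [ZMod.card_units_eq_totient, Nat.totient_prime hq] using hn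
  let e : Fin n ↪o X := (Fin.castLEOrderEmb (hnm.trans hX.ge)).trans
    (Fintype.orderIsoFinOfCardEq X rfl).toOrderEmbedding
  let ψ' : Fin n → Fin d → ZMod q := fun x i => ψ x i
  have hψ' : Function.Injective ψ' := by
    intro x y h
    refine ψ.injective (funext fun i => Units.ext (congrFun h i))
  refine (erdosGyarfas_le_card (fun x y => (f (e x) (e y), dotColor (ψ' x) (ψ' y)))
    fun S hS => ?_).trans ?_
  · by_contra hlt
    push Not at hlt
    have href := colors_refine (f := f) (f' := fun x y => (f (e x) (e y), dotColor (ψ' x) (ψ' y)))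
      (g := e) (S := S) Prod.fst (fun x _ y _ h => e.lt_iff_lt.2 h) (fun _ _ _ _ _ => rfl)
    have hcard : (S.image e).card = p := by
      rw [Finset.card_image_of_injective _ e.injective, hS]
    have hne : S.Nonempty := Finset.card_pos.1 (by omega)
    have ht := hf (S.image e) (hne.image _) (by omega)
    rw [hcard] at ht
    have htree := (href.2 (by omega) (ht.2 (by omega))).comp Prod.snd
    have := card_le_of_isTree_dotColor hψ' (fun a i => (ψ a i).ne_zero) hd htree
    omega
  · rw [Fintype.card_prod, card_dotColor, ZMod.card]
    exact Nat.mul_le_mul_right _ hK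

end Upper

/-! ### Asymptotics -/

section Asymptotics

theorem tendsto_sqrt_log : Tendsto (fun n : ℕ => Nat.sqrt (Nat.log 2 n)) atTop atTop := by
  refine tendsto_atTop_atTop.2 fun b => ⟨2 ^ (b * b), fun n hn => ?_⟩
  rw [Nat.le_sqrt]
  exact Nat.le_log_of_pow_le (by norm_num) hn

theorem log_le_two_mul_sqrt {x : ℝ} (hx : 0 < x) : Real.log x ≤ 2 * √x := by
  have h := Real.log_le_sub_one_of_pos (Real.sqrt_pos.2 hx)
  rw [Real.log_sqrt hx.le] at h
  linarith

/-- The number of colors that do not come from the field is at most `exp (O (s ^ (3 / 2)))`. -/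
theorem log_colors_le (C : ℝ) (hC : 1 ≤ C) (s : ℕ) (hs : 1 ≤ s) :
    Real.log (C * ((s + 2) * 4 ^ (s + 1) * (4 * s + 5) ^ (s + 1))) ≤
      (Real.log C + 22) * (s * √s) := by
  have hs' : (1 : ℝ) ≤ s := by exact_mod_cast hs
  have hr : 1 ≤ √(s : ℝ) := Real.one_le_sqrt.2 hs'
  have hl : Real.log (4 * s + 5) ≤ 6 * √s := by
    have h1 : √(4 * s + 5 : ℝ) ≤ 3 * √s := by
      rw [Real.sqrt_le_left (by positivity), mul_pow, Real.sq_sqrt (by positivity)]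
      linarith
    linarith [log_le_two_mul_sqrt (x := 4 * s + 5) (by positivity)]
  have hl2 : Real.log (s + 2) ≤ 6 * √s :=
    (Real.log_le_log (by positivity) (by linarith)).trans hl
  have hl4 : Real.log 4 ≤ 2 := by
    have h1 : √(4 : ℝ) = 2 := by
      rw [show (4 : ℝ) = 2 ^ 2 by norm_num]; exact Real.sqrt_sq (by norm_num)
    have h2 := Real.log_le_sub_one_of_pos (x := √4) (by positivity)
    rw [Real.log_sqrt (by norm_num), h1] at h2
    linarith
  have hC0 : 0 ≤ Real.log C := Real.log_nonneg hC
  rw [Real.log_mul (by positivity) (by positivity), Real.log_mul (by positivity) (by positivity),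
    Real.log_mul (by positivity) (by positivity), Real.log_pow, Real.log_pow]
  push_cast
  have hss : 1 ≤ s * √(s : ℝ) := by nlinarith
  have e1 : Real.log C ≤ Real.log C * (s * √s) := by nlinarith
  have e2 : 6 * √(s : ℝ) ≤ 6 * (s * √s) := by nlinarith
  have e3 : ((s : ℝ) + 1) * Real.log 4 ≤ 4 * (s * √s) := by nlinarith
  have e4 : ((s : ℝ) + 1) * Real.log (4 * s + 5) ≤ 12 * (s * √s) := by
    calc ((s : ℝ) + 1) * Real.log (4 * s + 5) ≤ (2 * s) * (6 * √s) :=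
          mul_le_mul (by linarith) hl (Real.log_nonneg (by linarith)) (by positivity)
      _ = _ := by ring
  linarith

/-- If a prime `q` of order `n ^ (1 / d)` and some `m` of order `√(log n)` give a coloring with the
stated number of colors, then this number is `n ^ (1 / d + o(1))`. -/
theorem exists_exponent {d p : ℕ} (hd : d ≠ 0)
    (h : ∀ n m q : ℕ, q.Prime → n ≤ (q - 1) ^ d → n ≤ 2 ^ (m * m) →
      erdosGyarfas n p p ≤ (m + 1) * 4 ^ m * (4 * m + 1) ^ m * (8 * (d + 1) * q)) :
    ∃ ε : ℕ → ℝ, Tendsto ε atTop (𝓝 0) ∧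
      ∀ᶠ n : ℕ in atTop, (erdosGyarfas n p p : ℝ) ≤ (n : ℝ) ^ ((1 : ℝ) / d + ε n) := by
  set C : ℝ := 32 * (d + 1) with hCdef
  have hC : 1 ≤ C := by
    have : (0 : ℝ) ≤ d := by positivity
    rw [hCdef]; linarith
  set s : ℕ → ℕ := fun n => Nat.sqrt (Nat.log 2 n) with hs
  set G : ℕ → ℝ := fun n => C * ((s n + 2) * 4 ^ (s n + 1) * (4 * s n + 5) ^ (s n + 1)) with hG
  have hG1 : ∀ n, 1 ≤ G n := by
    intro n
    have h0 : (0 : ℝ) ≤ s n := by positivity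
    refine one_le_mul_of_one_le_of_one_le hC (one_le_mul_of_one_le_of_one_le
      (one_le_mul_of_one_le_of_one_le (by linarith) (one_le_pow₀ (by norm_num)))
      (one_le_pow₀ (by linarith)))
  have hs1 : ∀ᶠ n in atTop, 1 ≤ s n := tendsto_sqrt_log.eventually_ge_atTop 1
  have hlogn : ∀ n : ℕ, n ≠ 0 → (s n : ℝ) * s n * Real.log 2 ≤ Real.log n := by
    intro n hn
    have h1 : 2 ^ (s n * s n) ≤ n :=
      (Nat.pow_le_pow_right (by norm_num) (Nat.sqrt_le _)).trans (Nat.pow_log_le_self 2 hn)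
    have h2 : ((2 : ℝ) ^ (s n * s n)) ≤ n := by exact_mod_cast h1
    have h3 := Real.log_le_log (by positivity) h2
    rw [Real.log_pow] at h3
    exact_mod_cast h3
  refine ⟨fun n => Real.log (G n) / Real.log n, ?_, ?_⟩
  · have hlim : Tendsto (fun n => (Real.log C + 22) / Real.log 2 / √(s n : ℝ)) atTop (𝓝 0) :=
      Tendsto.div_atTop tendsto_const_nhds
        (Real.tendsto_sqrt_atTop.comp (tendsto_natCast_atTop_atTop.comp tendsto_sqrt_log))
    refine tendsto_of_tendsto_of_tendsto_of_le_of_le' tendsto_const_nhds hlim ?_ ?_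
    · exact Eventually.of_forall fun n =>
        div_nonneg (Real.log_nonneg (hG1 n)) (Real.log_natCast_nonneg n)
    · filter_upwards [hs1, eventually_ge_atTop 1] with n hn hn1
      have hsn : (1 : ℝ) ≤ s n := by exact_mod_cast hn
      have hl2 : 0 < Real.log 2 := Real.log_pos (by norm_num)
      have hC0 : 0 ≤ Real.log C := Real.log_nonneg hC
      have hrt : 0 < √(s n : ℝ) := Real.sqrt_pos.2 (by linarith)
      calc Real.log (G n) / Real.log n
          ≤ ((Real.log C + 22) * (s n * √(s n))) / (s n * s n * Real.log 2) :=
            div_le_div₀ (by positivity) (log_colors_le C hC (s n) hn) (by positivity)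
              (hlogn n (by omega))
        _ = (Real.log C + 22) / Real.log 2 / √(s n : ℝ) := by
            have := Real.mul_self_sqrt (Nat.cast_nonneg (α := ℝ) (s n))
            rw [div_div, div_eq_div_iff (by positivity) (by positivity)]
            linear_combination (Real.log C + 22) * s n * Real.log 2 * this
  · filter_upwards [eventually_ge_atTop 2] with n hn
    have hn1 : (1 : ℝ) < n := by exact_mod_cast hn
    have hn0 : (0 : ℝ) < n := by linarith
    set x : ℝ := (n : ℝ) ^ ((1 : ℝ) / d) with hx
    have hx1 : 1 ≤ x := Real.one_le_rpow hn1.le (by positivity)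
    have hxd : x ^ d = n := by
      rw [hx, ← Real.rpow_natCast, ← Real.rpow_mul hn0.le, one_div,
        inv_mul_cancel₀ (by exact_mod_cast hd), Real.rpow_one]
    set r : ℕ := ⌈x⌉₊ with hr
    have hxr : x ≤ r := Nat.le_ceil x
    have hr0 : r ≠ 0 := by
      intro h0
      rw [h0] at hxr
      norm_num at hxr
      linarith
    obtain ⟨q, hq, hrq, hq2⟩ := Nat.exists_prime_lt_and_le_two_mul r hr0
    have hnq : n ≤ (q - 1) ^ d := by
      have h1 : (n : ℝ) ≤ (r : ℝ) ^ d := hxd ▸ pow_le_pow_left₀ (by linarith) hxr d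
      have h2 : n ≤ r ^ d := by exact_mod_cast h1
      exact h2.trans (Nat.pow_le_pow_left (by omega) d)
    have hnm : n ≤ 2 ^ ((s n + 1) * (s n + 1)) := by
      refine (Nat.lt_pow_succ_log_self (b := 2) (by norm_num) n).le.trans
        (Nat.pow_le_pow_right (by norm_num) ?_)
      exact Nat.succ_le_of_lt (Nat.lt_succ_sqrt _)
    have hq4 : (q : ℝ) ≤ 4 * x := by
      have h1 : (q : ℝ) ≤ 2 * r := by exact_mod_cast hq2
      have h2 : (r : ℝ) < x + 1 := Nat.ceil_lt_add_one (by linarith)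
      linarith
    have hb : (erdosGyarfas n p p : ℝ) ≤
        ((s n + 2) * 4 ^ (s n + 1) * (4 * s n + 5) ^ (s n + 1)) * (8 * (d + 1) * q) := by
      have h1 := h n (s n + 1) q hq hnq hnm
      have h2 : (erdosGyarfas n p p : ℝ) ≤ _ := Nat.cast_le.2 h1
      push_cast at h2
      refine h2.trans_eq ?_
      ring_nf
    have hGx : (n : ℝ) ^ (Real.log (G n) / Real.log n) = G n := by
      rw [Real.rpow_def_of_pos hn0, mul_div_cancel₀ _ (Real.log_pos hn1).ne',
        Real.exp_log (by linarith [hG1 n])]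
    rw [Real.rpow_add hn0, hGx, ← hx]
    refine hb.trans ?_
    calc _ ≤ (((s n : ℝ) + 2) * 4 ^ (s n + 1) * (4 * s n + 5) ^ (s n + 1)) *
          (8 * (d + 1) * (4 * x)) := by gcongr
      _ = x * G n := by rw [hG, hCdef]; ring

end Asymptotics

end ErdosGyarfas

theorem theorem2 :
    (∃ ε : ℕ → ℝ, Tendsto ε atTop (𝓝 0) ∧
      ∀ᶠ n : ℕ in atTop, (erdosGyarfas n 6 6 : ℝ) ≤ (n : ℝ) ^ ((1 : ℝ) / 3 + ε n)) ∧
    (∃ ε : ℕ → ℝ, Tendsto ε atTop (𝓝 0) ∧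
      ∀ᶠ n : ℕ in atTop, (erdosGyarfas n 8 8 : ℝ) ≤ (n : ℝ) ^ ((1 : ℝ) / 4 + ε n)) := by
  constructor
  · have h := ErdosGyarfas.exists_exponent (d := 3) (p := 6) (by norm_num) fun n m q hq hn hnm =>
      ErdosGyarfas.erdosGyarfas_le hq (by norm_num) (by norm_num) (by norm_num) hn hnm
    exact_mod_cast h
  · have h := ErdosGyarfas.exists_exponent (d := 4) (p := 8) (by norm_num) fun n m q hq hn hnm =>
      ErdosGyarfas.erdosGyarfas_le hq (by norm_num) (by norm_num) (by norm_num) hn hnm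
    exact_mod_cast h
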